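/- Let $m,N\in\mathbb N_0$. Let $\mathbf M_1,\mathbf M_2\in\mathbb R^{2\times2}$, let $\mathbf Q$ be a symmetric bilinear and $\mathbf C$ a symmetric trilinear map on $\mathbb R^2$ (with values in $\mathbb R^2$), and let $\hat U_0,\hat U_1,\hat U_0^*,\hat U_1^*\in\mathbb R^2$ satisfy $\mathbf M_1\hat U_0=-\hat U_0$, $\mathbf M_1\hat U_1=-\hat U_1+\hat U_0$, $\langle\hat U_i^*,\hat U_j\rangle=\delta_{ij}$. Put $c_0=\frac14\langle\hat U_1^*,-\mathbf M_2\hat U_0\rangle$. Consider the far-field system, for $0\le n\le N$, $$\mathbf u_n'=\mathbf v_n,\quad \mathbf v_n'=(mn)^2\sigma^2\mathbf u_n+\mathbf M_1\mathbf u_n-\sigma\mathbf v_n+\mathcal F_n,\quad \sigma'=-\sigma^2,$$ $$\mathcal F_n=\mu\mathbf M_2\mathbf u_n+\sum_{i+j=n}\mathbf Q(\mathbf u_{|i|},\mathbf u_{|j|})+\sum_{i+j+k=n}\mathbf C(\mathbf u_{|i|},\mathbf u_{|j|},\mathbf u_{|k|}),$$ where all summation indices run over $-N,\dots,N$. In the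 complex amplitudes $\tilde A_n=\frac12\langle\hat U_0^*,\mathbf u_n-i\mathbf v_n\rangle-\frac i4\langle\hat U_1^*,\mathbf v_n\rangle$, $\tilde B_n=-\frac i4\langle\hat U_1^*,\mathbf u_n-i\mathbf v_n\rangle$ it becomes $$\tilde A_n'=i\tilde A_n-\tfrac\sigma2(\tilde A_n-\overline{\tilde A_n})+\tilde B_n-\tfrac i2\Big[\sigma^2(mn)^2\big[(\tilde A_n+\overline{\tilde A_n})+i(\tilde B_n-\overline{\tilde B_n})\big]+\langle\hat U_0^*+\tfrac12\hat U_1^*,\mathcal F_n\rangle\Big],$$ $$\tilde B_n'=i\tilde B_n-\tfrac\sigma2(\tilde B_n+\overline{\tilde B_n})-\tfrac12\Big[\sigma^2(mn)^2\,i(\tilde B_n-\overline{\tilde B_n})+\langle\tfrac12\hat U_1^*,\mathcal F_n\rangle\Big],\qquad \sigma'=-\sigma^2,\tag{1}$$ with $\mathbf u_j=(\tilde A_j+\overline{\tilde A_j})\hat U_0+2i(\tilde B_j-\overline{\tilde B_j})\hat U_1$ inserted in $\mathcal F_n$. Write $\tilde z=(\tilde{\mathbf A},\tilde{\mathbf B})$,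 $z=(\mathbf A,\mathbf B)$, $|z|=|\mathbf A|+|\mathbf B|$. **Claim.** There are constants $K,\delta>0$ and, for each $n\in\{0,\dots,N\}$, a map $P_n$ with values in $\mathbb C^2$ that is polynomial in $\sigma$ and in the components of $\tilde z$ and of $\overline{\tilde z}$, of degree bounded uniformly in $\mu$, with coefficients smooth in $\mu\in\mathbb R$; a family of $\mathbb R$-linear, upper triangular maps $\mathcal T_n(\sigma):\mathbb C^2\to\mathbb C^2$ (that is, the second component of $\mathcal T_n(\sigma)(a,0)$ vanishes for all $a$); a function $k_n(\mu,\sigma)$; and remainders $[\mathbf R_{\mathbf A}]_n,[\mathbf R_{\mathbf B}]_n$, functions of $z,\sigma,\mu$ and of a vector of phases $\theta\in\mathbb R^{N+1}$, such that: 1. for $|\mu|,|\sigma|,|\tilde z|<\delta$: $\|\mathcal T_n(\sigma)\|\le K|\sigma|$ and $P_n=[\mathbb 1+\mathcal T_n(\sigma)](\tilde A_n,\tilde B_n)^T+\mathcal O((|\mu|+|\tilde z|)|\tilde z|)$ with constant $K$; and $P=(P_n)_n$ is a local change of coordinates near $0$: there is a map $S$, smooth in $(\mu,\sigma,z)$ for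 $|\mu|,|\sigma|,|z|<\delta$, that inverts $P(\mu,\sigma,\cdot)$ on both sides on the ball of radius $\delta$; 2. for $|\mu|,|\sigma|,|z|<\delta$ and all $\theta$: $|[\mathbf R_{\mathbf A/\mathbf B}]_n|\le K\,[\,|\mu|^2+|\sigma|^3+|z|^2\,]\,|z|$; 3. $|k_n(\mu,\sigma)-1|\le K(|\mu|+|\sigma|^2)$ for $|\mu|<\delta$ and all real $\sigma$; 4. for every $|\mu|<\delta$ and every solution $\sigma$ of $\sigma'=-\sigma^2$ on $(0,\infty)$ (in particular $\sigma=1/r$) there are phases $\phi_n:[0,\infty)\to\mathbb R$, continuous, with $\phi_n(0)=-\frac{mn\pi}2$ and $\phi_n'(r)=k_n(\mu,\sigma(r))$ for $r>0$, such that on every open set $J\subset(0,\infty)$ on which $|\sigma(r)|,|\tilde z(r)|<\delta$, with $$\begin{pmatrix}A_n\\B_n\end{pmatrix}=e^{-i\phi_n(r)}P_n(\tilde z,\overline{\tilde z},\sigma;\mu),$$ $\tilde z$ solves (1) if and only if $$\mathbf A'=-\tfrac\sigma2\mathbf A+\mathbf B+\mathbf R_{\mathbf A},\qquad \mathbf B'=-\tfrac\sigma2\mathbf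 B+c_0\mu\mathbf A+\mathbf R_{\mathbf B},$$ where the remainders are evaluated at $(\theta;z,\sigma,\mu)=(\phi(r);\mathbf A,\mathbf B,\sigma(r),\mu)$. -/

import Mathlib

open scoped Matrix ContDiff

noncomputable section

namespace FarField

/-- The plane, with the Euclidean inner product `x ⬝ᵥ y`. -/
abbrev Plane := Fin 2 → ℝ

/-- The coefficients of a planar two-component reaction-diffusion system
`0 = Δu - M₁ u - μ M₂ u - Q(u,u) - C(u,u,u)` at a Turing instability (wave number scaled to one):
`M₁` has the eigenvalue `-1`, algebraically double and geometrically simple, with generalised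
eigenvectors `U₀, U₁` and adjoint (dual) vectors `V₀, V₁`. -/
structure TuringData where
  M₁ : Matrix (Fin 2) (Fin 2) ℝ
  M₂ : Matrix (Fin 2) (Fin 2) ℝ
  Q : Plane →ₗ[ℝ] Plane →ₗ[ℝ] Plane
  C : Plane →ₗ[ℝ] Plane →ₗ[ℝ] Plane →ₗ[ℝ] Plane
  Q_symm : ∀ x y, Q x y = Q y x
  C_symm_left : ∀ x y z, C x y z = C y x z
  C_symm_right : ∀ x y z, C x y z = C x z y
  U₀ : Plane
  U₁ : Plane
  V₀ : Plane
  V₁ : Plane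
  eigen₀ : M₁ *ᵥ U₀ = -U₀
  eigen₁ : M₁ *ᵥ U₁ = -U₁ + U₀
  dual₀₀ : V₀ ⬝ᵥ U₀ = 1
  dual₀₁ : V₀ ⬝ᵥ U₁ = 0
  dual₁₀ : V₁ ⬝ᵥ U₀ = 0
  dual₁₁ : V₁ ⬝ᵥ U₁ = 1

/-- `c₀ = ¼ ⟨V₁, -M₂ U₀⟩`. -/
def TuringData.c₀ (D : TuringData) : ℝ := (1 / 4) * (D.V₁ ⬝ᵥ (-(D.M₂ *ᵥ D.U₀)))

/-- The Fourier index `|i|`, for `-N ≤ i ≤ N`. -/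
def mode (N : ℕ) (i : ℤ) : Fin (N + 1) := Fin.ofNat (N + 1) i.natAbs

/-- `μ M₂ u_n + ∑_{i+j=n} Q(u_|i|, u_|j|) + ∑_{i+j+k=n} C(u_|i|, u_|j|, u_|k|)`, all indices of the
sums running over `-N, …, N`. -/
def reaction (D : TuringData) {N : ℕ} (μ : ℝ) (u : Fin (N + 1) → Plane) (n : Fin (N + 1)) : Plane :=
  μ • (D.M₂ *ᵥ u n)
  + (∑ i ∈ Finset.Icc (-(N : ℤ)) N, ∑ j ∈ Finset.Icc (-(N : ℤ)) N,
      if i + j = (n : ℤ) then D.Q (u (mode N i)) (u (mode N j)) else 0)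
  + (∑ i ∈ Finset.Icc (-(N : ℤ)) N, ∑ j ∈ Finset.Icc (-(N : ℤ)) N,
      ∑ k ∈ Finset.Icc (-(N : ℤ)) N,
        if i + j + k = (n : ℤ) then D.C (u (mode N i)) (u (mode N j)) (u (mode N k)) else 0)

/-- The pair of complex amplitude vectors `(A, B)`, each indexed by the modes `0, …, N`. -/
abbrev Amp (N : ℕ) := (Fin (N + 1) → ℂ) × (Fin (N + 1) → ℂ)

/-- `|A| + |B|` (maximum norms). -/
def size {N : ℕ} (z : Amp N) : ℝ := ‖z.1‖ + ‖z.2‖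

/-- `u_n = (A_n + conj A_n) U₀ + 2i (B_n - conj B_n) U₁`, written with real coefficients. -/
def profile (D : TuringData) {N : ℕ} (z : Amp N) (n : Fin (N + 1)) : Plane :=
  (2 * (z.1 n).re) • D.U₀ + (-4 * (z.2 n).im) • D.U₁

/-- `v_n = [i (A_n - conj A_n) + (B_n + conj B_n)] U₀ - 2 (B_n + conj B_n) U₁`, written with real
coefficients. -/
def profileDeriv (D : TuringData) {N : ℕ} (z : Amp N) (n : Fin (N + 1)) : Plane :=
  (-2 * (z.1 n).im + 2 * (z.2 n).re) • D.U₀ + (-4 * (z.2 n).re) • D.U₁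

/-- The amplitudes of `(u, v)`:
`A_n = ½⟨V₀, u_n - i v_n⟩ - (i/4)⟨V₁, v_n⟩` and `B_n = -(i/4)⟨V₁, u_n - i v_n⟩`. -/
def amplitudes (D : TuringData) {N : ℕ} (u v : Fin (N + 1) → Plane) : Amp N :=
  (fun n => (1 / 2) * (((D.V₀ ⬝ᵥ u n : ℝ) : ℂ) - Complex.I * ((D.V₀ ⬝ᵥ v n : ℝ) : ℂ))
      - (Complex.I / 4) * ((D.V₁ ⬝ᵥ v n : ℝ) : ℂ),
   fun n => -(Complex.I / 4) * (((D.V₁ ⬝ᵥ u n : ℝ) : ℂ) - Complex.I * ((D.V₁ ⬝ᵥ v n : ℝ) : ℂ)))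

/-- The `v`-part of the far-field system
`u_n' = v_n`, `v_n' = (m n)² σ² u_n + M₁ u_n - σ v_n + reaction`, `σ' = -σ²`. -/
def farFieldV (D : TuringData) (m : ℕ) {N : ℕ} (μ σ : ℝ) (u v : Fin (N + 1) → Plane)
    (n : Fin (N + 1)) : Plane :=
  ((((m * (n : ℕ) : ℕ) : ℝ) ^ 2) * σ ^ 2) • u n + D.M₁ *ᵥ u n - σ • v n + reaction D μ u n

/-- The right-hand side of the amplitude system (equation for `A` and equation for `B`). -/
def ampField (D : TuringData) (m : ℕ) {N : ℕ} (μ σ : ℝ) (z : Amp N) : Amp N :=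
  (fun n =>
    Complex.I * z.1 n - (σ / 2 : ℂ) * (z.1 n - star (z.1 n)) + z.2 n
      - (Complex.I / 2) *
        ((σ : ℂ) ^ 2 * (((m * (n : ℕ) : ℕ) : ℝ) : ℂ) ^ 2 *
            ((z.1 n + star (z.1 n)) + Complex.I * (z.2 n - star (z.2 n)))
          + (((D.V₀ + (1 / 2 : ℝ) • D.V₁) ⬝ᵥ reaction D μ (profile D z) n : ℝ) : ℂ)),
   fun n =>
    Complex.I * z.2 n - (σ / 2 : ℂ) * (z.2 n + star (z.2 n))
      - (1 / 2 : ℂ) *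
        ((σ : ℂ) ^ 2 * (((m * (n : ℕ) : ℕ) : ℝ) : ℂ) ^ 2 *
            (Complex.I * (z.2 n - star (z.2 n)))
          + ((((1 / 2 : ℝ) • D.V₁) ⬝ᵥ reaction D μ (profile D z) n : ℝ) : ℂ)))

theorem TuringData.expand (D : TuringData) (x : Plane) :
    (D.V₀ ⬝ᵥ x) • D.U₀ + (D.V₁ ⬝ᵥ x) • D.U₁ = x := by
  have h1 : !![D.V₀ 0, D.V₀ 1; D.V₁ 0, D.V₁ 1] * !![D.U₀ 0, D.U₁ 0; D.U₀ 1, D.U₁ 1] = 1 := by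
    have h00 := D.dual₀₀
    have h01 := D.dual₀₁
    have h10 := D.dual₁₀
    have h11 := D.dual₁₁
    simp only [dotProduct, Fin.sum_univ_two] at h00 h01 h10 h11
    ext i j
    fin_cases i <;> fin_cases j <;> simp [Matrix.mul_apply, Fin.sum_univ_two, *]
  have h2 := mul_eq_one_comm.mp h1
  have e00 := congrFun (congrFun h2 0) 0
  have e01 := congrFun (congrFun h2 0) 1
  have e10 := congrFun (congrFun h2 1) 0
  have e11 := congrFun (congrFun h2 1) 1
  simp [Matrix.mul_apply, Fin.sum_univ_two] at e00 e01 e10 e11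
  ext i
  fin_cases i
  · simp [dotProduct, Fin.sum_univ_two]
    linear_combination x 0 * e00 + x 1 * e01
  · simp [dotProduct, Fin.sum_univ_two]
    linear_combination x 0 * e10 + x 1 * e11

theorem profile_amplitudes (D : TuringData) {N : ℕ} (u v : Fin (N + 1) → Plane) :
    profile D (amplitudes D u v) = u := by
  funext n
  rw [← D.expand (u n)]
  unfold profile amplitudes
  congr 2 <;> simp

/-- The linear map `amplitudes` carries the far-field vector field to the amplitude system. -/
theorem amplitudes_farField (D : TuringData) (m : ℕ) {N : ℕ} (μ σ : ℝ)
    (u v : Fin (N + 1) → Plane) :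
    amplitudes D v (farFieldV D m μ σ u v) = ampField D m μ σ (amplitudes D u v) := by
  have hM : ∀ x, D.V₀ ⬝ᵥ (D.M₁ *ᵥ x) = -(D.V₀ ⬝ᵥ x) + D.V₁ ⬝ᵥ x ∧
      D.V₁ ⬝ᵥ (D.M₁ *ᵥ x) = -(D.V₁ ⬝ᵥ x) := by
    intro x
    have h : D.M₁ *ᵥ x = (D.V₀ ⬝ᵥ x) • (-D.U₀) + (D.V₁ ⬝ᵥ x) • (-D.U₁ + D.U₀) := by
      conv_lhs => rw [← D.expand x]
      rw [Matrix.mulVec_add, Matrix.mulVec_smul, Matrix.mulVec_smul, D.eigen₀, D.eigen₁]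
    rw [h]
    simp only [dotProduct_add, dotProduct_smul, dotProduct_neg, D.dual₀₀, D.dual₀₁, D.dual₁₀,
      D.dual₁₁, smul_eq_mul]
    constructor <;> ring
  unfold ampField
  rw [profile_amplitudes]
  unfold farFieldV amplitudes
  ext n
  · simp only [dotProduct_add, dotProduct_sub, add_dotProduct, dotProduct_smul, smul_dotProduct,
      smul_eq_mul, (hM _).1, (hM _).2]
    generalize ((m * (n : ℕ) : ℕ) : ℝ) = a
    apply Complex.ext <;> simp [← Complex.ofReal_pow] <;> ring
  · simp only [dotProduct_add, dotProduct_sub, dotProduct_smul, smul_dotProduct,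
      smul_eq_mul, (hM _).2]
    generalize ((m * (n : ℕ) : ℕ) : ℝ) = a
    apply Complex.ext <;> simp [← Complex.ofReal_pow] <;> ring

/-- The variables `A_k, conj A_k, B_k, conj B_k` (`0 ≤ k ≤ N`) and `σ`. -/
inductive Var (N : ℕ) : Type
  | A (k : Fin (N + 1)) : Var N
  | Abar (k : Fin (N + 1)) : Var N
  | B (k : Fin (N + 1)) : Var N
  | Bbar (k : Fin (N + 1)) : Var N
  | sigma : Var N

/-- The values of the variables at the amplitudes `z` and at `σ`. -/
def Var.val {N : ℕ} (σ : ℝ) (z : Amp N) : Var N → ℂ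
  | .A k => z.1 k
  | .Abar k => star (z.1 k)
  | .B k => z.2 k
  | .Bbar k => star (z.2 k)
  | .sigma => (σ : ℂ)

/-- A polynomial in the amplitudes, their conjugates and `σ`, of a degree bounded uniformly in `μ`,
whose coefficients are smooth functions of `μ`. -/
def PolynomialSmooth {N : ℕ} (p : ℝ → MvPolynomial (Var N) ℂ) : Prop :=
  (∃ d : ℕ, ∀ μ, (p μ).totalDegree ≤ d) ∧ ∀ s, ContDiff ℝ ∞ (fun μ => (p μ).coeff s)

/-- The map of amplitude space with polynomial components `PA n μ`, `PB n μ`. -/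
def polyMap {N : ℕ} (PA PB : Fin (N + 1) → ℝ → MvPolynomial (Var N) ℂ) (μ σ : ℝ) (z : Amp N) :
    Amp N :=
  (fun n => MvPolynomial.eval (Var.val σ z) (PA n μ),
   fun n => MvPolynomial.eval (Var.val σ z) (PB n μ))

/-- Removal of the phases: `(A_n, B_n) ↦ e^{-i θ_n} (A_n, B_n)`. -/
def rotate {N : ℕ} (θ : Fin (N + 1) → ℝ) (z : Amp N) : Amp N :=
  (fun n => Complex.exp (-(Complex.I * (θ n : ℂ))) * z.1 n,
   fun n => Complex.exp (-(Complex.I * (θ n : ℂ))) * z.2 n)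

/-- The truncated radial Hamilton-Hopf normal form `(-σ/2 A + B, -σ/2 B + c₀ μ A)`. -/
def normalField {N : ℕ} (c₀ μ σ : ℝ) (w : Amp N) : Amp N :=
  (fun n => -(σ / 2 : ℂ) * w.1 n + w.2 n,
   fun n => -(σ / 2 : ℂ) * w.2 n + (c₀ : ℂ) * (μ : ℂ) * w.1 n)

end FarField

end

open FarField

/-! The proof is a normal form computation to second order. Give `μ`, `σ²` and `|y|` the same
weight, as in `gauge`: terms of size `gauge² |y|` fit into the remainder, as does `σ³ |y|`, but `σ
|y|²` does not.

Replacing `v` by `v + σ/2 u` (`shear`) spreads the friction `-σ v` evenly over `u` and `v`, at the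
price of turning `(mn)²` into `(mn)² - 1/4`. The field becomes `L y - σ/2 y + σ² G y + μ M y + Q(y,
y) + c(y)` (`shear_ampField`). Its damping is scalar, so it commutes with linear changes and creates
no linear term of order `σ μ`. The change `y + σ² S₂ y + μ S₁ y + H(y, y) + σ H₂(y, y)` then does
the reduction (`Reduction.hasDerivAt_change`, `Reduction.isBigO_defect`). `H` removes `Q`. The
damping acts twice on a quadratic term and leaves `-σ/2 H(y, y)`, which is too large for the
remainder; `H₂` removes it. Cubic terms may stay.

Quadratic terms are never resonant: products of two modes `e^{±ir}` have frequencies 0 and ±2, never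
±1 (`exists_homological_eq`). Among the linear terms, those in the conjugates are not resonant, and
the nilpotent part of `L` removes all others except a multiple of the identity and the coefficient
of `A` in the equation of `B`. The former is imaginary and goes into the phase velocity; the latter
is `c₀ μ`. In the phase velocity `σ²` is replaced by `cutoff σ`, which differs by at most `σ⁴` and
is bounded, so that the phases extend to `r = 0` even for `σ = 1/r`.

The inverse function theorem, with `μ` and `σ` as parameters, makes all this a genuine change of
coordinates (`exists_smooth_inverse`) and gives the converse implication (`hasDerivAt_of_normal`).
-/

noncomputable section

open Filter Topology Asymptotics

namespace FarField

/-! ### Orders of magnitude in `(μ, σ, y)`. -/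

section Orders

variable {E : Type*} [NormedAddCommGroup E]

/-- A globally bounded replacement of `σ²`. -/
def cutoff (σ : ℝ) : ℝ := σ ^ 2 / (1 + σ ^ 2)

/-- The order of magnitude of the perturbation relative to `y`. -/
def gauge (p : ℝ × ℝ × E) : ℝ := p.2.1 ^ 2 + |p.1| + ‖p.2.2‖

/-- The order of magnitude of the remainder. -/
def order (p : ℝ × ℝ × E) : ℝ := (|p.1| ^ 2 + |p.2.1| ^ 3 + ‖p.2.2‖ ^ 2) * ‖p.2.2‖

theorem gauge_nonneg (p : ℝ × ℝ × E) : 0 ≤ gauge p := by unfold gauge; positivity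

theorem cutoff_nonneg (σ : ℝ) : 0 ≤ cutoff σ := by unfold cutoff; positivity

theorem cutoff_le (σ : ℝ) : cutoff σ ≤ σ ^ 2 := by
  unfold cutoff
  exact div_le_self (by positivity) (by nlinarith [sq_nonneg σ])

theorem sub_cutoff_le (σ : ℝ) : σ ^ 2 - cutoff σ ≤ σ ^ 4 := by
  unfold cutoff
  have h : σ ^ 2 - σ ^ 2 / (1 + σ ^ 2) = σ ^ 4 / (1 + σ ^ 2) := by
    field_simp; ring
  rw [h]
  exact div_le_self (by positivity) (by nlinarith [sq_nonneg σ])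

theorem isBigO_sigma_sq : (fun p : ℝ × ℝ × E => p.2.1 ^ 2) =O[𝓝 0] gauge :=
  .of_norm_le fun p => by
    rw [Real.norm_of_nonneg (by positivity)]; unfold gauge
    linarith [abs_nonneg p.1, norm_nonneg p.2.2]

theorem isBigO_mu : (fun p : ℝ × ℝ × E => p.1) =O[𝓝 0] gauge :=
  .of_norm_le fun p => by
    rw [Real.norm_eq_abs]; unfold gauge
    linarith [sq_nonneg p.2.1, norm_nonneg p.2.2]

theorem isBigO_vec : (fun p : ℝ × ℝ × E => p.2.2) =O[𝓝 0] gauge :=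
  .of_norm_le fun p => by
    unfold gauge
    linarith [sq_nonneg p.2.1, abs_nonneg p.1]

theorem isBigO_cutoff : (fun p : ℝ × ℝ × E => cutoff p.2.1) =O[𝓝 0] gauge :=
  .trans (.of_norm_le fun p => by
    rw [Real.norm_of_nonneg (cutoff_nonneg _)]; exact cutoff_le _) isBigO_sigma_sq

theorem isBigO_sigma : (fun p : ℝ × ℝ × E => p.2.1) =O[𝓝 0] (fun _ => (1 : ℝ)) :=
  (continuous_fst.comp continuous_snd).continuousAt.isBigO_one ℝ

theorem isBigO_gauge_one : (gauge : ℝ × ℝ × E → ℝ) =O[𝓝 0] (fun _ => (1 : ℝ)) :=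
  Continuous.continuousAt (by unfold gauge; fun_prop) |>.isBigO_one ℝ

theorem isBigO_gauge_mul {f : ℝ × ℝ × E → ℝ} :
    (fun p => gauge p * f p) =O[𝓝 0] f := by
  simpa using isBigO_gauge_one.mul (isBigO_refl f (𝓝 (0 : ℝ × ℝ × E)))

theorem eventually_abs_sigma_le : ∀ᶠ p : ℝ × ℝ × E in 𝓝 0, |p.2.1| ≤ 1 := by
  have h : Continuous fun p : ℝ × ℝ × E => |p.2.1| := by fun_prop
  exact (h.tendsto' 0 0 (by simp)).eventually (eventually_le_nhds one_pos)

theorem isBigO_gauge_sq :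
    (fun p : ℝ × ℝ × E => gauge p * (gauge p * ‖p.2.2‖)) =O[𝓝 0] order := by
  -- The constant is that of `(a + b + c)² ≤ 3 (a² + b² + c²)`; then `σ⁴ ≤ |σ|³`.
  refine .of_bound 3 (eventually_abs_sigma_le.mono fun p hp => ?_)
  have hg := gauge_nonneg p
  rw [Real.norm_of_nonneg (by positivity), Real.norm_of_nonneg (by unfold order; positivity)]
  unfold order gauge
  rw [← mul_assoc, ← mul_assoc]
  refine mul_le_mul_of_nonneg_right ?_ (norm_nonneg _)
  rw [← sq_abs p.2.1]
  have h4 : |p.2.1| ^ 4 ≤ |p.2.1| ^ 3 := pow_le_pow_of_le_one (abs_nonneg _) hp (by norm_num)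
  nlinarith [sq_nonneg (|p.2.1| ^ 2 - |p.1|), sq_nonneg (|p.2.1| ^ 2 - ‖p.2.2‖),
    sq_nonneg (|p.1| - ‖p.2.2‖)]

/-- Needed for the derivative `-2σ³` of `σ²` along `σ' = -σ²`, the one term of the defect that is
not quadratic in `gauge`. -/
theorem isBigO_sigma_cube :
    (fun p : ℝ × ℝ × E => p.2.1 ^ 3 * ‖p.2.2‖) =O[𝓝 0] order :=
  .of_norm_le fun p => by
    rw [norm_mul, norm_norm, norm_pow, Real.norm_eq_abs]
    unfold order
    gcongr
    nlinarith [sq_nonneg (‖p.2.2‖), sq_nonneg |p.1|]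

end Orders

/-! ### The abstract reduction and its local inverse. -/

section NormalForm

variable {E : Type*} [NormedAddCommGroup E] [NormedSpace ℝ E]

/-- The coefficients of a field `L y - σ/2 y + σ² G y + μ M y + Q(y, y) + c(y)`, together with a
solution `(S₁, S₂, H, H₂)` of the homological equations that reduce it to
`L y - σ/2 y + μ K₁ y + σ² K₂ y` up to terms of higher order. -/
structure Reduction (E : Type*) [NormedAddCommGroup E] [NormedSpace ℝ E] where
  L : E →L[ℝ] E
  G : E →L[ℝ] E
  M : E →L[ℝ] E
  Q : E →L[ℝ] E →L[ℝ] E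
  c : E → E
  K₁ : E →L[ℝ] E
  K₂ : E →L[ℝ] E
  S₁ : E →L[ℝ] E
  S₂ : E →L[ℝ] E
  H : E →L[ℝ] E →L[ℝ] E
  H₂ : E →L[ℝ] E →L[ℝ] E
  c_bound : ∃ k, ∀ y, ‖c y‖ ≤ k * ‖y‖ ^ 3
  hom₁ : ∀ y, L (S₁ y) = M y + S₁ (L y) - K₁ y
  hom₂ : ∀ y, L (S₂ y) = G y + S₂ (L y) - K₂ y
  homH : ∀ y, L (H y y) = H (L y) y + H y (L y) + Q y y
  homH₂ : ∀ y, L (H₂ y y) = H₂ (L y) y + H₂ y (L y) - (1 / 2 : ℝ) • H y y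

namespace Reduction

variable (d : Reduction E)

/-- The part of the field of higher order than `L y - σ/2 y`. -/
def perturbation (μ σ : ℝ) (y : E) : E :=
  σ ^ 2 • d.G y + μ • d.M y + d.Q y y + d.c y

/-- The vector field to be reduced. -/
def field (μ σ : ℝ) (y : E) : E := d.L y - (σ / 2) • y + d.perturbation μ σ y

/-- The near-identity change of coordinates minus the identity. -/
def shift (μ σ : ℝ) (y : E) : E :=
  σ ^ 2 • d.S₂ y + μ • d.S₁ y + d.H y y + σ • d.H₂ y y

/-- The near-identity change of coordinates. -/
def change (μ σ : ℝ) (y : E) : E := y + d.shift μ σ y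

/-- The reduced field. -/
def reduced (μ σ : ℝ) (y : E) : E :=
  d.L y - (σ / 2) • y + μ • d.K₁ y + cutoff σ • d.K₂ y

/-- The remainder of the reduction, as a function of the old coordinates. -/
def defect (μ σ : ℝ) (y : E) : E :=
  σ ^ 2 • d.S₂ (d.perturbation μ σ y) + μ • d.S₁ (d.perturbation μ σ y)
    + d.H (d.perturbation μ σ y) y + d.H y (d.perturbation μ σ y)
    + σ • (d.H₂ (d.perturbation μ σ y) y + d.H₂ y (d.perturbation μ σ y))
    + d.c y - (2 * σ ^ 3) • d.S₂ y - (3 / 2 * σ ^ 2) • d.H₂ y y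
    - μ • d.K₁ (d.shift μ σ y) - cutoff σ • d.K₂ (d.shift μ σ y)
    + (σ ^ 2 - cutoff σ) • d.K₂ y

/-- By the chain rule, the homological equations cancel every term of first order in `gauge` except
those in `K₁` and `K₂`. The factor `3/2` in the defect collects three contributions to `σ² H₂`: `-1`
from `σ'`, `-1` from the damping of both arguments, `+1/2` from the damping of the target. -/
theorem hasDerivAt_change (μ : ℝ) {σ : ℝ → ℝ} {y : ℝ → E} {r : ℝ}
    (hσ : HasDerivAt σ (-(σ r) ^ 2) r) (hy : HasDerivAt y (d.field μ (σ r) (y r)) r) :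
    HasDerivAt (fun s => d.change μ (σ s) (y s))
      (d.reduced μ (σ r) (d.change μ (σ r) (y r)) + d.defect μ (σ r) (y r)) r := by
  have lin : ∀ S : E →L[ℝ] E, HasDerivAt (fun s => S (y s)) (S (d.field μ (σ r) (y r))) r :=
    fun S => S.hasFDerivAt.comp_hasDerivAt r hy
  have bil : ∀ H : E →L[ℝ] E →L[ℝ] E, HasDerivAt (fun s => H (y s) (y s))
      (H (d.field μ (σ r) (y r)) (y r) + H (y r) (d.field μ (σ r) (y r))) r := fun H =>
    (H.hasFDerivAt.comp_hasDerivAt r hy).clm_apply hy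
  have h := hy.add (((((hσ.pow 2).smul (lin d.S₂)).add ((lin d.S₁).const_smul μ)).add
    (bil d.H)).add (hσ.smul (bil d.H₂)))
  refine h.congr_deriv ?_
  simp only [reduced, defect, change]
  have hK₁ : d.K₁ (y r + d.shift μ (σ r) (y r)) = d.K₁ (y r) + d.K₁ (d.shift μ (σ r) (y r)) :=
    map_add _ _ _
  have hK₂ : d.K₂ (y r + d.shift μ (σ r) (y r)) = d.K₂ (y r) + d.K₂ (d.shift μ (σ r) (y r)) :=
    map_add _ _ _
  -- The only place where the homological equations enter.
  have hL : d.L (y r + d.shift μ (σ r) (y r)) = d.L (y r) +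
      ((σ r) ^ 2 • (d.G (y r) + d.S₂ (d.L (y r)) - d.K₂ (y r))
        + μ • (d.M (y r) + d.S₁ (d.L (y r)) - d.K₁ (y r))
        + (d.H (d.L (y r)) (y r) + d.H (y r) (d.L (y r)) + d.Q (y r) (y r))
        + σ r • (d.H₂ (d.L (y r)) (y r) + d.H₂ (y r) (d.L (y r))
          - (1 / 2 : ℝ) • d.H (y r) (y r))) := by
    simp only [shift, map_add, map_smul, d.hom₁, d.hom₂, d.homH, d.homH₂]
  rw [hK₁, hK₂, hL]
  have hf : ∀ S : E →L[ℝ] E, S (d.field μ (σ r) (y r)) =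
      S (d.L (y r)) - (σ r / 2) • S (y r) + S (d.perturbation μ (σ r) (y r)) := by
    intro S; simp only [field, map_add, map_sub, map_smul]
  have hf1 : ∀ H : E →L[ℝ] E →L[ℝ] E, H (d.field μ (σ r) (y r)) (y r) =
      H (d.L (y r)) (y r) - (σ r / 2) • H (y r) (y r)
        + H (d.perturbation μ (σ r) (y r)) (y r) := by
    intro S; simp [field]
  simp only [hf, hf1]
  rw [show d.field μ (σ r) (y r) = d.L (y r) - (σ r / 2) • y r +
    ((σ r) ^ 2 • d.G (y r) + μ • d.M (y r) + d.Q (y r) (y r) + d.c (y r)) from rfl]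
  rw [show y r + d.shift μ (σ r) (y r) = y r + ((σ r) ^ 2 • d.S₂ (y r) + μ • d.S₁ (y r)
    + d.H (y r) (y r) + σ r • d.H₂ (y r) (y r)) from rfl]
  -- Every operator value is now an atom, and what remains is an identity of linear combinations.
  generalize d.perturbation μ (σ r) (y r) = Z
  generalize d.shift μ (σ r) (y r) = D
  generalize cutoff (σ r) = s
  simp only [Nat.cast_ofNat, Nat.add_one_sub_one, pow_one, Pi.pow_apply]
  module

theorem isBigO_lin (S : E →L[ℝ] E) :
    (fun p : ℝ × ℝ × E => S p.2.2) =O[𝓝 0] (fun p => ‖p.2.2‖) :=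
  (S.isBigO_comp _ _).norm_right

theorem isBigO_bil (H : E →L[ℝ] E →L[ℝ] E) {f g : ℝ × ℝ × E → E} {a b : ℝ × ℝ × E → ℝ}
    (hf : f =O[𝓝 0] a) (hg : g =O[𝓝 0] b) :
    (fun p => H (f p) (g p)) =O[𝓝 0] (fun p => a p * b p) := by
  refine .trans (.of_bound ‖H‖ (.of_forall fun p => ?_)) (hf.norm_left.mul hg.norm_left)
  rw [norm_mul, norm_norm, norm_norm, ← mul_assoc]
  exact H.le_opNorm₂ _ _

theorem isBigO_cubic :
    (fun p : ℝ × ℝ × E => d.c p.2.2) =O[𝓝 0] (fun p => gauge p * (gauge p * ‖p.2.2‖)) := by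
  obtain ⟨k, hk⟩ := d.c_bound
  have h1 : (fun p : ℝ × ℝ × E => d.c p.2.2) =O[𝓝 0] (fun p => ‖p.2.2‖ * (‖p.2.2‖ * ‖p.2.2‖)) :=
    .of_bound k (.of_forall fun p => by
      rw [Real.norm_of_nonneg (by positivity)]
      exact (hk _).trans_eq (by ring))
  exact h1.trans (isBigO_vec.norm_left.mul (isBigO_vec.norm_left.mul (isBigO_refl _ _)))

theorem isBigO_sigma_smul {f : ℝ × ℝ × E → E} {g : ℝ × ℝ × E → ℝ} (h : f =O[𝓝 0] g) :
    (fun p => p.2.1 • f p) =O[𝓝 0] g := by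
  simpa using isBigO_sigma.smul h

theorem isBigO_perturbation :
    (fun p : ℝ × ℝ × E => d.perturbation p.1 p.2.1 p.2.2) =O[𝓝 0]
      (fun p => gauge p * ‖p.2.2‖) := by
  unfold perturbation
  refine (((isBigO_sigma_sq.smul (isBigO_lin d.G)).add (isBigO_mu.smul (isBigO_lin d.M))).add
    (isBigO_bil d.Q isBigO_vec (isBigO_refl _ _).norm_right)).add
    (d.isBigO_cubic.trans isBigO_gauge_mul)

theorem isBigO_shift :
    (fun p : ℝ × ℝ × E => d.shift p.1 p.2.1 p.2.2) =O[𝓝 0] (fun p => gauge p * ‖p.2.2‖) := by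
  unfold shift
  exact (((isBigO_sigma_sq.smul (isBigO_lin d.S₂)).add (isBigO_mu.smul (isBigO_lin d.S₁))).add
    (isBigO_bil d.H isBigO_vec (isBigO_refl _ _).norm_right)).add
    (isBigO_sigma_smul (isBigO_bil d.H₂ isBigO_vec (isBigO_refl _ _).norm_right))

/-- Each term has two factors `gauge` besides a `|y|`, from a perturbation or shift inserted into a
map that is itself small, or else the factor `σ³`. -/
theorem isBigO_defect :
    (fun p : ℝ × ℝ × E => d.defect p.1 p.2.1 p.2.2) =O[𝓝 0] order := by
  have two := isBigO_gauge_sq (E := E)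
  have hZ := d.isBigO_perturbation
  have hD := d.isBigO_shift
  have comp : ∀ (S : E →L[ℝ] E) {f : ℝ × ℝ × E → E} {g : ℝ × ℝ × E → ℝ}, f =O[𝓝 0] g →
      (fun p => S (f p)) =O[𝓝 0] g := fun S _ _ h => (S.isBigO_comp _ _).trans h
  have hy : (fun p : ℝ × ℝ × E => p.2.2) =O[𝓝 0] (fun p => ‖p.2.2‖) :=
    (isBigO_refl _ _).norm_right
  have left : ∀ H : E →L[ℝ] E →L[ℝ] E,
      (fun p : ℝ × ℝ × E => H (d.perturbation p.1 p.2.1 p.2.2) p.2.2) =O[𝓝 0] order := fun H =>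
    ((isBigO_bil H hZ isBigO_vec).congr_right fun p => by ring).trans two
  have right : ∀ H : E →L[ℝ] E →L[ℝ] E,
      (fun p : ℝ × ℝ × E => H p.2.2 (d.perturbation p.1 p.2.1 p.2.2)) =O[𝓝 0] order := fun H =>
    (isBigO_bil H isBigO_vec hZ).trans two
  unfold defect
  refine (((((((((((isBigO_sigma_sq.smul (comp d.S₂ hZ)).trans two).add
    ((isBigO_mu.smul (comp d.S₁ hZ)).trans two)).add (left d.H)).add (right d.H)).add
    (isBigO_sigma_smul ((left d.H₂).add (right d.H₂)))).add
    (d.isBigO_cubic.trans two)).sub ?_).sub ?_).sub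
    ((isBigO_mu.smul (comp d.K₁ hD)).trans two)).sub
    ((isBigO_cutoff.smul (comp d.K₂ hD)).trans two)).add ?_
  · have h : (fun p : ℝ × ℝ × E => 2 * p.2.1 ^ 3) =O[𝓝 0] (fun p => p.2.1 ^ 3) :=
      isBigO_const_mul_self _ _ _
    exact (h.smul (comp d.S₂ hy)).trans isBigO_sigma_cube
  · have h : (fun p : ℝ × ℝ × E => 3 / 2 * p.2.1 ^ 2) =O[𝓝 0] gauge :=
      (isBigO_const_mul_self _ _ _).trans isBigO_sigma_sq
    exact (h.smul (isBigO_bil d.H₂ isBigO_vec hy)).trans two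
  · have h : (fun p : ℝ × ℝ × E => p.2.1 ^ 2 - cutoff p.2.1) =O[𝓝 0]
        (fun p => gauge p * gauge p) := by
      refine .trans (.of_norm_le fun p => ?_) (isBigO_sigma_sq.mul isBigO_sigma_sq)
      rw [Real.norm_of_nonneg (sub_nonneg.2 (cutoff_le _))]
      exact (sub_cutoff_le _).trans_eq (by ring)
    exact ((h.smul (comp d.K₂ hy)).congr_right fun p => by
      simp only [smul_eq_mul]; ring).trans two

theorem contDiff_change :
    ContDiff ℝ ω (fun p : ℝ × ℝ × E => d.change p.1 p.2.1 p.2.2) := by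
  unfold change shift
  fun_prop

end Reduction

/-- The inverse function theorem for `(μ, σ, y) ↦ (μ, σ, F)`, whose derivative at 0 is the identity
by `hsmall`. Keeping the parameters as coordinates gives joint smoothness and a neighbourhood
uniform in them. -/
theorem exists_smooth_inverse [CompleteSpace E] {F : ℝ × ℝ × E → E} (hF : ContDiff ℝ ω F)
    (hsmall : (fun p => F p - p.2.2) =o[𝓝 0] (fun p => p.2.2)) :
    ∃ S : ℝ × ℝ × E → E, (∀ᶠ p in 𝓝 0, ContDiffAt ℝ ω S p) ∧ S =O[𝓝 0] (fun p => p.2.2) ∧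
      Tendsto (fun p => (p.1, p.2.1, S p)) (𝓝 0) (𝓝 0) ∧
      (∀ᶠ p in 𝓝 0, S (p.1, p.2.1, F p) = p.2.2) ∧
      ∀ᶠ p in 𝓝 0, F (p.1, p.2.1, S p) = p.2.2 := by
  set Φ : ℝ × ℝ × E → ℝ × ℝ × E := fun p => (p.1, p.2.1, F p) with hΦ
  have hΦc : ContDiff ℝ ω Φ := contDiff_fst.prodMk (contDiff_snd.fst.prodMk hF)
  -- The estimate `hsmall` forces `F 0 = 0`, since its right-hand side vanishes there.
  have h0 : Φ 0 = 0 := by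
    have := hsmall.isBigO.eq_zero_imp.self_of_nhds (by simp)
    simp only [Prod.snd_zero, sub_zero] at this
    simp [hΦ, this]
  have hd : HasFDerivAt Φ ((ContinuousLinearEquiv.refl ℝ (ℝ × ℝ × E) : _ →L[ℝ] _)) 0 := by
    rw [hasFDerivAt_iff_isLittleO, h0]
    have h1 : (fun p : ℝ × ℝ × E => p.2.2) =O[𝓝 0] (fun p => p) :=
      .of_bound 1 (.of_forall fun p => by
        simpa using (norm_snd_le p.2).trans (norm_snd_le p))
    have h2 : (fun p => ((0 : ℝ), (0 : ℝ), F p - p.2.2)) =o[𝓝 0] (fun p => p) := by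
      refine (IsLittleO.of_norm_left ?_)
      simpa [Prod.norm_def] using (hsmall.trans_isBigO h1).norm_left
    refine h2.congr (fun p => ?_) (fun p => by simp)
    exact Prod.ext (by simp [hΦ]) (Prod.ext (by simp [hΦ]) (by simp [hΦ]))
  have hne : (ω : WithTop ℕ∞) ≠ 0 := by simp
  have hΦ0 : ContDiffAt ℝ ω Φ 0 := hΦc.contDiffAt
  set Ψ := hΦ0.localInverse hd hne with hΨ
  have hΨc : ContDiffAt ℝ ω Ψ 0 := by
    have := hΦ0.to_localInverse hd hne
    rwa [h0] at this
  have hs := hΦ0.hasStrictFDerivAt' hd hne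
  have hl : ∀ᶠ p in 𝓝 0, Ψ (Φ p) = p := hs.eventually_left_inverse
  have hr : ∀ᶠ p in 𝓝 0, Φ (Ψ p) = p := by
    have := hs.eventually_right_inverse
    rwa [h0] at this
  have hΨ0 : Ψ 0 = 0 := by simpa [h0] using hl.self_of_nhds
  have ht : Tendsto Ψ (𝓝 0) (𝓝 0) := by simpa [ContinuousAt, hΨ0] using hΨc.continuousAt
  have heq : ∀ᶠ p in 𝓝 0, (p.1, p.2.1, (Ψ p).2.2) = Ψ p := hr.mono fun p hp => by
    have h1 : (Φ (Ψ p)).1 = p.1 := congrArg Prod.fst hp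
    have h2 : (Φ (Ψ p)).2.1 = p.2.1 := congrArg (fun q => q.2.1) hp
    rw [← h1, ← h2]
  have hFr : ∀ᶠ p in 𝓝 0, F (Ψ p) = p.2.2 := hr.mono fun p hp => congrArg (fun q => q.2.2) hp
  refine ⟨fun p => (Ψ p).2.2, ?_, ?_, ?_, ?_, ?_⟩
  · filter_upwards [hΨc.eventually (by simp)] with p hp
    exact hp.snd.snd
  · have h1 : (fun p : ℝ × ℝ × E => p.2.2) =O[𝓝 0] F := by
      exact hsmall.right_isBigO_add.congr_right fun p => by simp
    exact (h1.comp_tendsto ht).congr' .rfl hFr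
  · exact ht.congr' (heq.mono fun p hp => hp.symm)
  · exact hl.mono fun p hp => congrArg (fun q => q.2.2) hp
  · filter_upwards [heq, hFr] with p h1 h2
    rw [h1, h2]

end NormalForm

/-! ### Solvability of the quadratic homological equation. -/

section Homological

variable {E : Type*} [AddCommGroup E] [Module ℝ E]

/-- Derivative of the bilinear form `b` along `L`, minus `L ∘ b`. -/
def homological (L : E →ₗ[ℝ] E) : Module.End ℝ (E →ₗ[ℝ] E →ₗ[ℝ] E) where
  toFun b := b ∘ₗ L + b.compl₂ L - b.compr₂ L
  map_add' b b' := by ext; simp; abel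
  map_smul' t b := by ext; simp; module

@[simp]
theorem homological_apply (L : E →ₗ[ℝ] E) (b : E →ₗ[ℝ] E →ₗ[ℝ] E) (x y : E) :
    homological L b x y = b (L x) y + b x (L y) - L (b x y) := rfl

/-- The operator `h` is a sum of three commuting operators of square `-1`, so its eigenvalues lie
among `±i, ±3i`. Hence `(h² + 1)(h² + 9) = 0`, that is `h (h³ + 10 h) = -9`, which displays the
inverse. -/
theorem isUnit_homological_of_sq_eq_neg_one {J : E →ₗ[ℝ] E} (hJ : ∀ x, J (J x) = -x) :
    IsUnit (homological J) := by
  have key : homological J * (homological J ^ 3 + (10 : ℝ) • homological J) = -(9 : ℝ) • 1 := by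
    ext b x y
    simp [pow_succ, hJ]
    module
  have key' : (homological J ^ 3 + (10 : ℝ) • homological J) * homological J = -(9 : ℝ) • 1 := by
    rw [← key]
    simp [mul_add, add_mul, pow_succ, mul_assoc]
  refine ⟨⟨homological J, (-(9 : ℝ)⁻¹) • (homological J ^ 3 + (10 : ℝ) • homological J),
    ?_, ?_⟩, rfl⟩
  · rw [mul_smul_comm, key, smul_smul]; norm_num
  · rw [smul_mul_assoc, key', smul_smul]; norm_num

/-- A sum of three commuting operators of square zero: each product of four of them repeats a
factor. -/
theorem isNilpotent_homological {N : E →ₗ[ℝ] E} (hN : ∀ x, N (N x) = 0) :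
    IsNilpotent (homological N) := by
  refine ⟨4, ?_⟩
  ext b x y
  simp [pow_succ, hN]

/-- A unit plus a commuting nilpotent is a unit. -/
theorem exists_homological_eq {J N : E →ₗ[ℝ] E} (hJ : ∀ x, J (J x) = -x) (hN : ∀ x, N (N x) = 0)
    (hJN : ∀ x, J (N x) = N (J x)) (q : E →ₗ[ℝ] E →ₗ[ℝ] E) :
    ∃ b : E →ₗ[ℝ] E →ₗ[ℝ] E, ∀ x y,
      b ((J + N) x) y + b x ((J + N) y) - (J + N) (b x y) = q x y := by
  have hc : Commute (homological J) (homological N) := by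
    ext b x y
    simp [hJN]
    abel
  have hu := IsNilpotent.isUnit_add_left_of_commute (R := Module.End ℝ (E →ₗ[ℝ] E →ₗ[ℝ] E))
    (isNilpotent_homological hN) (isUnit_homological_of_sq_eq_neg_one hJ) hc.symm
  obtain ⟨u, hu⟩ := hu
  refine ⟨(↑u⁻¹ : Module.End ℝ _) q, fun x y => ?_⟩
  have h : (homological J + homological N) ((↑u⁻¹ : Module.End ℝ _) q) = q := by
    have h1 := u.mul_inv
    rw [hu] at h1
    exact congrArg (fun f : Module.End ℝ _ => f q) h1
  have := congrArg (fun b => b x y) h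
  rw [← this]
  simp
  abel

end Homological

/-! ### Linear terms of a single mode and their normal forms. -/

section Modes

variable {N : ℕ}

/-- The real-linear form `a A + a' conj A + b B + b' conj B`. -/
def modeForm (a a' b b' : ℂ) : ℂ × ℂ →ₗ[ℝ] ℂ where
  toFun x := a * x.1 + a' * star x.1 + b * x.2 + b' * star x.2
  map_add' x y := by simp; ring
  map_smul' t x := by simp; ring

@[simp]
theorem modeForm_apply (a a' b b' : ℂ) (x : ℂ × ℂ) :
    modeForm a a' b b' x = a * x.1 + a' * star x.1 + b * x.2 + b' * star x.2 := rfl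

/-- The map of amplitude space that acts by `t n` on the `n`-th pair of amplitudes. -/
def modewise (t : Fin (N + 1) → ℂ × ℂ →ₗ[ℝ] ℂ × ℂ) : Amp N →ₗ[ℝ] Amp N where
  toFun z := (fun n => (t n (z.1 n, z.2 n)).1, fun n => (t n (z.1 n, z.2 n)).2)
  map_add' x y := by
    have h : ∀ n, t n (x.1 n + y.1 n, x.2 n + y.2 n) = t n (x.1 n, x.2 n) + t n (y.1 n, y.2 n) :=
      fun n => by rw [← map_add]; rfl
    ext n <;> simp [h]
  map_smul' c x := by
    have h : ∀ n, t n (c • x.1 n, c • x.2 n) = c • t n (x.1 n, x.2 n) :=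
      fun n => by rw [← map_smul]; rfl
    ext n <;> simp only [Prod.smul_fst, Prod.smul_snd, Pi.smul_apply, h, RingHom.id_apply]

@[simp]
theorem modewise_fst (t : Fin (N + 1) → ℂ × ℂ →ₗ[ℝ] ℂ × ℂ) (z : Amp N) (n : Fin (N + 1)) :
    (modewise t z).1 n = (t n (z.1 n, z.2 n)).1 := rfl

@[simp]
theorem modewise_snd (t : Fin (N + 1) → ℂ × ℂ →ₗ[ℝ] ℂ × ℂ) (z : Amp N) (n : Fin (N + 1)) :
    (modewise t z).2 n = (t n (z.1 n, z.2 n)).2 := rfl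

/-- `(A, B) ↦ (i A, i B)`. -/
def phaseMode : ℂ × ℂ →ₗ[ℝ] ℂ × ℂ :=
  (modeForm Complex.I 0 0 0).prod (modeForm 0 0 Complex.I 0)

/-- `(A, B) ↦ (B, 0)`. -/
def nilMode : ℂ × ℂ →ₗ[ℝ] ℂ × ℂ := (modeForm 0 0 1 0).prod (modeForm 0 0 0 0)

/-- The effect of `v ↦ v + σ/2 u` on the amplitudes, divided by `σ`. -/
def shearMode : ℂ × ℂ →ₗ[ℝ] ℂ × ℂ :=
  (modeForm (-(Complex.I / 4)) (-(Complex.I / 4)) (1 / 4) (-(1 / 4))).prod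
    (modeForm 0 0 (-(Complex.I / 4)) (Complex.I / 4))

/-- The linear terms of order `σ²` after the shear. -/
def radialMode (q : ℝ) : ℂ × ℂ →ₗ[ℝ] ℂ × ℂ :=
  (modeForm (-(Complex.I * q / 2)) (-(Complex.I * q / 2)) (q / 2) (-(q / 2))).prod
    (modeForm 0 0 (-(Complex.I * q / 2)) (Complex.I * q / 2))

/-- The linear terms of order `σ²` of the normal form. -/
def radialNormal (q : ℝ) : ℂ × ℂ →ₗ[ℝ] ℂ × ℂ :=
  (modeForm (-(Complex.I * q / 2)) 0 0 0).prod (modeForm 0 0 (-(Complex.I * q / 2)) 0)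

/-- The linear terms of order `σ²` of the change of coordinates. -/
def radialChange (q : ℝ) : ℂ × ℂ →ₗ[ℝ] ℂ × ℂ :=
  (modeForm 0 (-(q / 4)) 0 (Complex.I * q / 2)).prod (modeForm 0 0 (q / 2) (q / 4))

/-- The linear terms of order `μ`. -/
def paramMode (m₁ m₂ c₀ k : ℝ) : ℂ × ℂ →ₗ[ℝ] ℂ × ℂ :=
  (modeForm (-(Complex.I * m₁ / 2)) (-(Complex.I * m₁ / 2)) m₂ (-m₂)).prod
    (modeForm c₀ c₀ (-(Complex.I * k / 2)) (Complex.I * k / 2))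

/-- The linear terms of order `μ` of the normal form. -/
def paramNormal (m₁ c₀ k : ℝ) : ℂ × ℂ →ₗ[ℝ] ℂ × ℂ :=
  (modeForm (-(Complex.I * (k + m₁) / 4)) 0 0 0).prod
    (modeForm c₀ 0 (-(Complex.I * (k + m₁) / 4)) 0)

/-- The linear terms of order `μ` of the change of coordinates. -/
def paramChange (m₁ m₂ c₀ k : ℝ) : ℂ × ℂ →ₗ[ℝ] ℂ × ℂ :=
  (modeForm 0 ((c₀ - m₁) / 4) 0
    (-(Complex.I / 2) * ((c₀ - m₁) / 4 - (k - c₀) / 4 - m₂))).prod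
    (modeForm (Complex.I * (k - m₁) / 4) (-(Complex.I * c₀ / 2)) m₂ ((k - c₀) / 4))

/-- The terms in the conjugates and the `B` in the equation of `A` are removed. The two diagonal
entries agree already, so `radialChange` needs no entry from `A` to `B`. -/
theorem radial_homological (q : ℝ) (x : ℂ × ℂ) :
    (phaseMode + nilMode) (radialChange q x) =
      radialMode q x + radialChange q ((phaseMode + nilMode) x) - radialNormal q x := by
  obtain ⟨A, B⟩ := x
  ext
  · simp [phaseMode, nilMode, radialChange, radialMode, radialNormal]
    ring_nf
    simp only [Complex.I_sq]
    ring
  · simp [phaseMode, nilMode, radialChange, radialMode, radialNormal]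
    ring

/-- On complex-linear maps the commutator with `nilMode` has the traceless upper triangular matrices
as its range. Hence the trace and the lower left entry `c₀` survive. The trace is shared equally
between `A` and `B`, so that one phase serves both. -/
theorem param_homological (m₁ m₂ c₀ k : ℝ) (x : ℂ × ℂ) :
    (phaseMode + nilMode) (paramChange m₁ m₂ c₀ k x) =
      paramMode m₁ m₂ c₀ k x + paramChange m₁ m₂ c₀ k ((phaseMode + nilMode) x)
        - paramNormal m₁ c₀ k x := by
  obtain ⟨A, B⟩ := x
  ext <;> simp [phaseMode, nilMode, paramChange, paramMode, paramNormal] <;> ring_nf <;>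
  simp only [Complex.I_sq] <;> ring

end Modes

set_option maxSynthPendingDepth 3 in
theorem exists_trilinear_bound {E : Type*} [NormedAddCommGroup E] [NormedSpace ℝ E]
    [FiniteDimensional ℝ E] (t : E →ₗ[ℝ] E →ₗ[ℝ] E →ₗ[ℝ] E) :
    ∃ k, ∀ x y z, ‖t x y z‖ ≤ k * ‖x‖ * ‖y‖ * ‖z‖ := by
  let f : E →ₗ[ℝ] (E →L[ℝ] E →L[ℝ] E) :=
    { toFun := fun x => (t x).toContinuousBilinearMap
      map_add' := fun x y => by ext; simp
      map_smul' := fun c x => by ext; simp }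
  refine ⟨‖LinearMap.toContinuousLinearMap f‖, fun x y z => ((f x).le_opNorm₂ y z).trans ?_⟩
  gcongr
  exact (LinearMap.toContinuousLinearMap f).le_opNorm x

/-! ### The coefficients of the reaction terms. -/

section Coefficients

variable (D : TuringData) (m : ℕ) {N : ℕ}

/-- `profile` as a linear map. -/
def profileLin : Amp N →ₗ[ℝ] Fin (N + 1) → Plane where
  toFun z := profile D z
  map_add' x y := by
    funext n
    simp only [profile, Prod.fst_add, Prod.snd_add, Pi.add_apply, Complex.add_re, Complex.add_im]
    module
  map_smul' c x := by
    funext n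
    simp only [profile, Prod.smul_fst, Prod.smul_snd, Pi.smul_apply, Complex.smul_re,
      Complex.smul_im, smul_eq_mul, RingHom.id_apply]
    module

@[simp]
theorem profileLin_apply (z : Amp N) : profileLin D z = profile D z := rfl

/-- The contribution of a reaction term to the amplitude equations. -/
def forcing : (Fin (N + 1) → Plane) →ₗ[ℝ] Amp N where
  toFun f := (fun n => -(Complex.I / 2) * (((D.V₀ + (1 / 2 : ℝ) • D.V₁) ⬝ᵥ f n : ℝ) : ℂ),
    fun n => -(1 / 2 : ℂ) * ((((1 / 2 : ℝ) • D.V₁) ⬝ᵥ f n : ℝ) : ℂ))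
  map_add' f g := by ext n <;> simp only [Pi.add_apply, Prod.fst_add, Prod.snd_add,
    dotProduct_add, Complex.ofReal_add] <;> ring
  map_smul' c f := by
    ext n <;> simp only [Pi.smul_apply, Prod.smul_fst, Prod.smul_snd, dotProduct_smul,
      smul_eq_mul, Complex.ofReal_mul, RingHom.id_apply, Complex.real_smul] <;> ring

/-- The quadratic part of the reaction terms. -/
def quadratic : (Fin (N + 1) → Plane) →ₗ[ℝ] (Fin (N + 1) → Plane) →ₗ[ℝ] (Fin (N + 1) → Plane) :=
  ∑ i ∈ Finset.Icc (-(N : ℤ)) N, ∑ j ∈ Finset.Icc (-(N : ℤ)) N,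
    (D.Q.compl₁₂ (LinearMap.proj (mode N i)) (LinearMap.proj (mode N j))).compr₂
      (LinearMap.pi fun n => if i + j = (n : ℤ) then LinearMap.id else 0)

/-- The cubic part of the reaction terms. -/
def cubic (u : Fin (N + 1) → Plane) (n : Fin (N + 1)) : Plane :=
  ∑ i ∈ Finset.Icc (-(N : ℤ)) N, ∑ j ∈ Finset.Icc (-(N : ℤ)) N,
    ∑ k ∈ Finset.Icc (-(N : ℤ)) N,
      if i + j + k = (n : ℤ) then D.C (u (mode N i)) (u (mode N j)) (u (mode N k)) else 0

theorem reaction_eq (μ : ℝ) (u : Fin (N + 1) → Plane) :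
    reaction D μ u = μ • (fun n => D.M₂ *ᵥ u n) + quadratic D u u + cubic D u := by
  funext n
  simp only [reaction, quadratic, cubic, Pi.add_apply, Pi.smul_apply]
  congr 2
  simp only [LinearMap.sum_apply, Finset.sum_apply]
  refine Finset.sum_congr rfl fun i _ => Finset.sum_congr rfl fun j _ => ?_
  simp only [LinearMap.compr₂_apply, LinearMap.compl₁₂_apply, LinearMap.proj_apply,
    LinearMap.pi_apply]
  split_ifs <;> simp

theorem exists_cubic_bound :
    ∃ k, ∀ z : Amp N, ‖forcing D (cubic D (profile D z))‖ ≤ k * ‖z‖ ^ 3 := by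
  obtain ⟨k, hk⟩ := exists_trilinear_bound D.C
  set I := Finset.Icc (-(N : ℤ)) N
  have hk0 : 0 ≤ |k| := abs_nonneg k
  have hcub : ∀ u : Fin (N + 1) → Plane, ‖cubic D u‖ ≤ (I.card : ℝ) ^ 3 * |k| * ‖u‖ ^ 3 := by
    intro u
    have hterm : ∀ i j l : ℤ, ∀ n : Fin (N + 1), ‖(if i + j + l = (n : ℤ) then
        D.C (u (mode N i)) (u (mode N j)) (u (mode N l)) else 0)‖ ≤ |k| * ‖u‖ ^ 3 := by
      intro i j l n
      split_ifs
      · refine (hk _ _ _).trans ?_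
        calc k * ‖u (mode N i)‖ * ‖u (mode N j)‖ * ‖u (mode N l)‖
            ≤ |k| * ‖u‖ * ‖u‖ * ‖u‖ := by
              gcongr <;> first | exact le_abs_self k | exact norm_le_pi_norm u _
          _ = |k| * ‖u‖ ^ 3 := by ring
      · simp only [norm_zero]; positivity
    refine (pi_norm_le_iff_of_nonneg (by positivity)).2 fun n => ?_
    have h1 := norm_sum_le_of_le I fun i _ => norm_sum_le_of_le I fun j _ =>
      norm_sum_le_of_le I fun l _ => hterm i j l n
    refine h1.trans_eq ?_
    simp only [Finset.sum_const, nsmul_eq_mul]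
    ring
  set F := LinearMap.toContinuousLinearMap (forcing D (N := N))
  set P := LinearMap.toContinuousLinearMap (profileLin D (N := N))
  refine ⟨‖F‖ * ((I.card : ℝ) ^ 3 * |k| * ‖P‖ ^ 3), fun z => ?_⟩
  calc ‖F (cubic D (profile D z))‖ ≤ ‖F‖ * ‖cubic D (profile D z)‖ := F.le_opNorm _
    _ ≤ ‖F‖ * ((I.card : ℝ) ^ 3 * |k| * ‖P z‖ ^ 3) := by gcongr; exact hcub _
    _ ≤ ‖F‖ * ((I.card : ℝ) ^ 3 * |k| * (‖P‖ * ‖z‖) ^ 3) := by gcongr; exact P.le_opNorm z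
    _ = _ := by ring

/-- `(m n)² - 1/4`. -/
def radialCoeff (n : Fin (N + 1)) : ℝ := ((m * (n : ℕ) : ℕ) : ℝ) ^ 2 - 1 / 4

/-- `⟨V₀ + V₁/2, M₂ U₀⟩`. -/
def coeffA₀ : ℝ := (D.V₀ + (1 / 2 : ℝ) • D.V₁) ⬝ᵥ (D.M₂ *ᵥ D.U₀)

/-- `⟨V₀ + V₁/2, M₂ U₁⟩`. -/
def coeffA₁ : ℝ := (D.V₀ + (1 / 2 : ℝ) • D.V₁) ⬝ᵥ (D.M₂ *ᵥ D.U₁)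

/-- `⟨V₁, M₂ U₁⟩`. -/
def coeffB₁ : ℝ := D.V₁ ⬝ᵥ (D.M₂ *ᵥ D.U₁)

/-- The origin of `c₀`: the equation of `B` contains `-¼ ⟨V₁, M₂ U₀⟩ (A + conj A)`. -/
theorem forcing_linear (z : Amp N) :
    forcing D (fun n => D.M₂ *ᵥ profile D z n) =
      modewise (fun _ => paramMode (coeffA₀ D) (coeffA₁ D) D.c₀ (coeffB₁ D)) z := by
  ext n <;>
  simp only [forcing, profile, Matrix.mulVec_add, Matrix.mulVec_smul, dotProduct_add,
    dotProduct_smul, smul_dotProduct, smul_eq_mul, LinearMap.coe_mk, AddHom.coe_mk,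
    modewise_fst, modewise_snd, paramMode, LinearMap.prod_apply, Function.prod, modeForm_apply] <;>
  simp only [coeffA₀, coeffA₁, coeffB₁, TuringData.c₀, dotProduct_neg] <;>
  generalize (D.V₀ + (1 / 2 : ℝ) • D.V₁) ⬝ᵥ (D.M₂ *ᵥ D.U₀) = a <;>
  generalize (D.V₀ + (1 / 2 : ℝ) • D.V₁) ⬝ᵥ (D.M₂ *ᵥ D.U₁) = b <;>
  apply Complex.ext <;> simp <;> ring

end Coefficients

/-! ### The amplitude system as an instance of the reduction. -/

section Amplitudes

variable (D : TuringData) (m : ℕ) {N : ℕ}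

theorem modewise_comp_eq {s t u v : Fin (N + 1) → ℂ × ℂ →ₗ[ℝ] ℂ × ℂ}
    (h : ∀ n x, s n (t n x) = u n x + t n (s n x) - v n x) (z : Amp N) :
    modewise s (modewise t z) = modewise u z + modewise t (modewise s z) - modewise v z := by
  ext n
  · exact congrArg Prod.fst (h n (z.1 n, z.2 n))
  · exact congrArg Prod.snd (h n (z.1 n, z.2 n))

/-- `(A, B) ↦ (i A + B, i B)` in every mode. -/
def linearPart : Amp N →ₗ[ℝ] Amp N := modewise fun _ => phaseMode + nilMode

theorem exists_homological_linearPart (q : Amp N →ₗ[ℝ] Amp N →ₗ[ℝ] Amp N) :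
    ∃ b : Amp N →ₗ[ℝ] Amp N →ₗ[ℝ] Amp N, ∀ x y,
      b (linearPart x) y + b x (linearPart y) - linearPart (b x y) = q x y := by
  have hL : linearPart = modewise (fun _ => phaseMode) + modewise (N := N) (fun _ => nilMode) :=
    rfl
  rw [hL]
  refine exists_homological_eq (fun x => ?_) (fun x => ?_) (fun x => ?_) q
  · ext n <;> simp [phaseMode, ← mul_assoc]
  · ext n <;> simp [nilMode]
  · ext n <;> simp [phaseMode, nilMode]

/-- A solution of the homological equation. -/
def homologicalInverse (q : Amp N →ₗ[ℝ] Amp N →ₗ[ℝ] Amp N) : Amp N →ₗ[ℝ] Amp N →ₗ[ℝ] Amp N :=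
  (exists_homological_linearPart q).choose

theorem linearPart_homologicalInverse (q : Amp N →ₗ[ℝ] Amp N →ₗ[ℝ] Amp N) (x y : Amp N) :
    linearPart (homologicalInverse q x y) = homologicalInverse q (linearPart x) y
      + homologicalInverse q x (linearPart y) - q x y := by
  rw [← (exists_homological_linearPart q).choose_spec x y]
  simp [homologicalInverse]

/-- The quadratic terms of the amplitude system. -/
def quadraticAmp : Amp N →ₗ[ℝ] Amp N →ₗ[ℝ] Amp N :=
  ((quadratic D).compl₁₂ (profileLin D) (profileLin D)).compr₂ (forcing D)

/-- The reduction of the amplitude system, after the shear, to the normal form. -/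
def ampReduction : Reduction (Amp N) where
  L := LinearMap.toContinuousLinearMap linearPart
  G := LinearMap.toContinuousLinearMap (modewise fun n => radialMode (radialCoeff m n))
  M := LinearMap.toContinuousLinearMap
    (modewise fun _ => paramMode (coeffA₀ D) (coeffA₁ D) D.c₀ (coeffB₁ D))
  Q := (quadraticAmp D).toContinuousBilinearMap
  c z := forcing D (cubic D (profile D z))
  K₁ := LinearMap.toContinuousLinearMap
    (modewise fun _ => paramNormal (coeffA₀ D) D.c₀ (coeffB₁ D))
  K₂ := LinearMap.toContinuousLinearMap (modewise fun n => radialNormal (radialCoeff m n))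
  S₁ := LinearMap.toContinuousLinearMap
    (modewise fun _ => paramChange (coeffA₀ D) (coeffA₁ D) D.c₀ (coeffB₁ D))
  S₂ := LinearMap.toContinuousLinearMap (modewise fun n => radialChange (radialCoeff m n))
  H := (homologicalInverse (-quadraticAmp D)).toContinuousBilinearMap
  H₂ := (homologicalInverse
    ((1 / 2 : ℝ) • homologicalInverse (-quadraticAmp D))).toContinuousBilinearMap
  c_bound := exists_cubic_bound D
  hom₁ := modewise_comp_eq fun _ => param_homological _ _ _ _
  hom₂ := modewise_comp_eq fun _ => radial_homological _
  homH y := by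
    have h := linearPart_homologicalInverse (-quadraticAmp D) y y
    simp only [LinearMap.neg_apply, sub_neg_eq_add] at h
    exact h
  homH₂ y := linearPart_homologicalInverse
    ((1 / 2 : ℝ) • homologicalInverse (-quadraticAmp D)) y y

/-- The effect of `v ↦ v + σ/2 u` on the amplitudes. -/
def shear (σ : ℝ) (z : Amp N) : Amp N := z + σ • modewise (fun _ => shearMode) z

/-- The shear changes `v` only, and the reaction terms depend on `u` only. -/
theorem profile_shear (σ : ℝ) (z : Amp N) : profile D (shear σ z) = profile D z := by
  funext n
  simp [profile, shear, shearMode]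

theorem ampReduction_field (μ σ : ℝ) (y : Amp N) :
    (ampReduction D m).field μ σ y = linearPart y - (σ / 2) • y
      + σ ^ 2 • modewise (fun n => radialMode (radialCoeff m n)) y
      + forcing D (reaction D μ (profile D y)) := by
  have h : forcing D (reaction D μ (profile D y)) =
      μ • modewise (fun _ => paramMode (coeffA₀ D) (coeffA₁ D) D.c₀ (coeffB₁ D)) y
        + forcing D (quadratic D (profile D y) (profile D y))
        + forcing D (cubic D (profile D y)) := by
    rw [reaction_eq, map_add, map_add, map_smul, forcing_linear]
  rw [h]
  change linearPart y - (σ / 2) • y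
    + (σ ^ 2 • modewise (fun n => radialMode (radialCoeff m n)) y
      + μ • modewise (fun _ => paramMode (coeffA₀ D) (coeffA₁ D) D.c₀ (coeffB₁ D)) y
      + forcing D (quadratic D (profile D y) (profile D y))
      + forcing D (cubic D (profile D y))) = _
  abel

/-- The subtracted term is the contribution of `σ' = -σ²`, so the left side is the velocity of the
sheared amplitudes. -/
theorem shear_ampField (μ σ : ℝ) (z : Amp N) :
    shear σ (ampField D m μ σ z) - σ ^ 2 • modewise (fun _ => shearMode) z =
      (ampReduction D m).field μ σ (shear σ z) := by
  rw [ampReduction_field, profile_shear]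
  unfold ampField forcing linearPart shear
  generalize reaction D μ (profile D z) = F
  ext n
  · simp only [Prod.fst_sub, Prod.fst_add, Prod.smul_fst, Pi.sub_apply, Pi.add_apply,
      Pi.smul_apply, modewise_fst, LinearMap.coe_mk, AddHom.coe_mk, radialCoeff]
    generalize ((m * (n : ℕ) : ℕ) : ℝ) = a
    apply Complex.ext <;>
    simp [phaseMode, nilMode, shearMode, radialMode, ← Complex.ofReal_pow] <;> ring
  · simp only [Prod.snd_sub, Prod.snd_add, Prod.smul_snd, Pi.sub_apply, Pi.add_apply,
      Pi.smul_apply, modewise_snd, LinearMap.coe_mk, AddHom.coe_mk, radialCoeff]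
    generalize ((m * (n : ℕ) : ℕ) : ℝ) = a
    apply Complex.ext <;>
    simp [phaseMode, nilMode, shearMode, radialMode, ← Complex.ofReal_pow] <;> ring

end Amplitudes

/-! ### The coordinate change is polynomial. -/

section Polynomials

variable {N : ℕ}

/-- `f` is given by a polynomial in the amplitudes, their conjugates and `σ`. -/
def IsPoly (f : ℝ → Amp N → ℂ) : Prop :=
  ∃ p : MvPolynomial (Var N) ℂ, ∀ σ z, MvPolynomial.eval (Var.val σ z) p = f σ z

/-- The variable of the conjugate. -/
def Var.bar : Var N → Var N
  | .A k => .Abar k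
  | .Abar k => .A k
  | .B k => .Bbar k
  | .Bbar k => .B k
  | .sigma => .sigma

theorem Var.val_bar (σ : ℝ) (z : Amp N) (v : Var N) :
    Var.val σ z v.bar = starRingEnd ℂ (Var.val σ z v) := by
  cases v <;> simp [Var.bar, Var.val]

namespace IsPoly

variable {f g : ℝ → Amp N → ℂ}

theorem add (hf : IsPoly f) (hg : IsPoly g) : IsPoly fun σ z => f σ z + g σ z := by
  obtain ⟨p, hp⟩ := hf
  obtain ⟨q, hq⟩ := hg
  exact ⟨p + q, fun σ z => by simp [hp, hq]⟩

theorem mul (hf : IsPoly f) (hg : IsPoly g) : IsPoly fun σ z => f σ z * g σ z := by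
  obtain ⟨p, hp⟩ := hf
  obtain ⟨q, hq⟩ := hg
  exact ⟨p * q, fun σ z => by simp [hp, hq]⟩

theorem const (c : ℂ) : IsPoly fun (_ : ℝ) (_ : Amp N) => c :=
  ⟨MvPolynomial.C c, fun σ z => by simp⟩

theorem sigma : IsPoly fun (σ : ℝ) (_ : Amp N) => (σ : ℂ) :=
  ⟨MvPolynomial.X .sigma, fun σ z => by simp [Var.val]⟩

theorem sum {ι : Type*} (s : Finset ι) {f : ι → ℝ → Amp N → ℂ} (hf : ∀ i, IsPoly (f i)) :
    IsPoly fun σ z => ∑ i ∈ s, f i σ z := by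
  choose p hp using hf
  exact ⟨∑ i ∈ s, p i, fun σ z => by simp [hp]⟩

/-- Conjugate the coefficients and exchange each variable with its conjugate; `σ` is real and stays.
-/
theorem conj (hf : IsPoly f) : IsPoly fun σ z => starRingEnd ℂ (f σ z) := by
  obtain ⟨p, hp⟩ := hf
  refine ⟨MvPolynomial.rename Var.bar (MvPolynomial.map (starRingEnd ℂ) p), fun σ z => ?_⟩
  change _ = starRingEnd ℂ (f σ z)
  rw [MvPolynomial.eval_rename, ← hp, MvPolynomial.eval_map, ← MvPolynomial.eval₂_id,
    MvPolynomial.hom_eval₂, RingHom.comp_id]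
  congr 1
  funext v
  exact Var.val_bar σ z v

theorem re (hf : IsPoly f) : IsPoly fun σ z => ((f σ z).re : ℂ) := by
  have h := (hf.add hf.conj).mul (const (1 / 2))
  convert h using 3 with σ z
  rw [Complex.add_conj]
  push_cast
  ring

theorem im (hf : IsPoly f) : IsPoly fun σ z => ((f σ z).im : ℂ) := by
  have h := ((const (-Complex.I)).mul hf).re
  convert h using 4 with σ z
  simp

end IsPoly

/-- The basis vectors of amplitude space, in the order `A`, `i A`, `B`, `i B`. -/
def ampBasis : Fin 4 × Fin (N + 1) → Amp N
  | (0, n) => (Pi.single n 1, 0)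
  | (1, n) => (Pi.single n Complex.I, 0)
  | (2, n) => (0, Pi.single n 1)
  | (3, n) => (0, Pi.single n Complex.I)

/-- The real coordinates in amplitude space. -/
def ampCoord (z : Amp N) : Fin 4 × Fin (N + 1) → ℝ
  | (0, n) => (z.1 n).re
  | (1, n) => (z.1 n).im
  | (2, n) => (z.2 n).re
  | (3, n) => (z.2 n).im

theorem sum_ampCoord (z : Amp N) : ∑ i, ampCoord z i • ampBasis i = z := by
  rw [Fintype.sum_prod_type]
  ext k <;>
  simp [Fin.sum_univ_four, ampCoord, ampBasis, Prod.fst_sum, Prod.snd_sum, Finset.sum_apply,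
    Pi.single_apply, Complex.re_add_im]

/-- All components are polynomial. -/
def IsPolyVec (y : ℝ → Amp N → Amp N) : Prop :=
  (∀ n, IsPoly fun σ z => (y σ z).1 n) ∧ ∀ n, IsPoly fun σ z => (y σ z).2 n

namespace IsPolyVec

variable {x y : ℝ → Amp N → Amp N}

theorem id : IsPolyVec fun (_ : ℝ) (z : Amp N) => z :=
  ⟨fun n => ⟨.X (.A n), fun σ z => by simp [Var.val]⟩,
    fun n => ⟨.X (.B n), fun σ z => by simp [Var.val]⟩⟩

theorem add (hx : IsPolyVec x) (hy : IsPolyVec y) : IsPolyVec fun σ z => x σ z + y σ z :=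
  ⟨fun n => (hx.1 n).add (hy.1 n), fun n => (hx.2 n).add (hy.2 n)⟩

theorem smul {c : ℝ → Amp N → ℝ} (hc : IsPoly fun σ z => (c σ z : ℂ)) (hy : IsPolyVec y) :
    IsPolyVec fun σ z => c σ z • y σ z :=
  ⟨fun n => by simpa using hc.mul (hy.1 n), fun n => by simpa using hc.mul (hy.2 n)⟩

theorem sigma_smul (hy : IsPolyVec y) : IsPolyVec fun σ z => σ • y σ z := smul .sigma hy

theorem sum {ι : Type*} (s : Finset ι) {y : ι → ℝ → Amp N → Amp N} (hy : ∀ i, IsPolyVec (y i)) :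
    IsPolyVec fun σ z => ∑ i ∈ s, y i σ z :=
  ⟨fun n => by simpa [Prod.fst_sum] using IsPoly.sum s fun i => (hy i).1 n,
    fun n => by simpa [Prod.snd_sum] using IsPoly.sum s fun i => (hy i).2 n⟩

theorem coord (hy : IsPolyVec y) (i : Fin 4 × Fin (N + 1)) :
    IsPoly fun σ z => (ampCoord (y σ z) i : ℂ) := by
  obtain ⟨i, n⟩ := i
  fin_cases i
  · exact (hy.1 n).re
  · exact (hy.1 n).im
  · exact (hy.2 n).re
  · exact (hy.2 n).im

theorem const (a : Amp N) : IsPolyVec fun (_ : ℝ) (_ : Amp N) => a :=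
  ⟨fun _ => .const _, fun _ => .const _⟩

/-- A real-linear map is determined by its values on `ampBasis`, and real coordinates are
polynomials in the amplitudes and their conjugates. -/
theorem linear (T : Amp N →ₗ[ℝ] Amp N) (hy : IsPolyVec y) : IsPolyVec fun σ z => T (y σ z) := by
  have h := IsPolyVec.sum Finset.univ fun i => smul (hy.coord i) (const (T (ampBasis i)))
  convert h using 3 with σ z
  conv_lhs => rw [← sum_ampCoord (y σ z)]
  simp only [map_sum, map_smul]

theorem bilinear (b : Amp N →ₗ[ℝ] Amp N →ₗ[ℝ] Amp N) (hx : IsPolyVec x) (hy : IsPolyVec y) :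
    IsPolyVec fun σ z => b (x σ z) (y σ z) := by
  have h := IsPolyVec.sum Finset.univ fun i => smul (hx.coord i) (hy.linear (b (ampBasis i)))
  convert h using 3 with σ z
  conv_lhs => rw [← sum_ampCoord (x σ z)]
  simp only [map_sum, map_smul, LinearMap.sum_apply, LinearMap.smul_apply]

end IsPolyVec

theorem polynomialSmooth_affine (p q : MvPolynomial (Var N) ℂ) :
    PolynomialSmooth fun μ : ℝ => p + MvPolynomial.C (μ : ℂ) * q := by
  refine ⟨⟨max p.totalDegree q.totalDegree, fun μ => ?_⟩, fun s => ?_⟩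
  · refine (MvPolynomial.totalDegree_add _ _).trans (max_le_max le_rfl ?_)
    refine (MvPolynomial.totalDegree_mul _ _).trans ?_
    simp
  · simp only [MvPolynomial.coeff_add, MvPolynomial.coeff_C_mul]
    exact contDiff_const.add (Complex.ofRealCLM.contDiff.mul contDiff_const)

variable (D : TuringData) (m : ℕ)

/-- The coordinate change of amplitude space. -/
def ampChange (μ σ : ℝ) (z : Amp N) : Amp N := (ampReduction D m).change μ σ (shear σ z)

/-- The part of the coordinate change that does not depend on `μ`. -/
def ampChange₀ (σ : ℝ) (y : Amp N) : Amp N :=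
  y + (σ • σ • modewise (fun n => radialChange (radialCoeff m n)) y
    + homologicalInverse (-quadraticAmp D) y y
    + σ • homologicalInverse ((1 / 2 : ℝ) • homologicalInverse (-quadraticAmp D)) y y)

/-- The coefficient of `μ` in the coordinate change. -/
def ampChange₁ : Amp N →ₗ[ℝ] Amp N :=
  modewise fun _ => paramChange (coeffA₀ D) (coeffA₁ D) D.c₀ (coeffB₁ D)

theorem ampReduction_change (μ σ : ℝ) (y : Amp N) :
    (ampReduction D m).change μ σ y = y
      + (σ ^ 2 • modewise (fun n => radialChange (radialCoeff m n)) y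
      + μ • modewise (fun _ => paramChange (coeffA₀ D) (coeffA₁ D) D.c₀ (coeffB₁ D)) y
      + homologicalInverse (-quadraticAmp D) y y
      + σ • homologicalInverse ((1 / 2 : ℝ) • homologicalInverse (-quadraticAmp D)) y y) := rfl

theorem ampChange_eq (μ σ : ℝ) (z : Amp N) :
    ampChange D m μ σ z = ampChange₀ D m σ (shear σ z) + μ • ampChange₁ D (shear σ z) := by
  rw [ampChange, ampReduction_change, ampChange₀, ampChange₁]
  module

theorem isPolyVec_shear : IsPolyVec (N := N) fun σ z => shear σ z :=
  IsPolyVec.id.add (IsPolyVec.id.linear (modewise fun _ => shearMode)).sigma_smul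

theorem isPolyVec_ampChange₀ :
    IsPolyVec (N := N) fun σ z => ampChange₀ D m σ (shear σ z) := by
  have hs := isPolyVec_shear (N := N)
  unfold ampChange₀
  exact hs.add ((((hs.linear _).sigma_smul.sigma_smul).add (hs.bilinear _ hs)).add
    (hs.bilinear _ hs).sigma_smul)

theorem isPolyVec_ampChange₁ :
    IsPolyVec (N := N) fun σ z => ampChange₁ D (shear σ z) := isPolyVec_shear.linear _

theorem IsPolyVec.polyMap_affine {x y : ℝ → Amp N → Amp N}
    {p0 q0 p1 q1 : Fin (N + 1) → MvPolynomial (Var N) ℂ}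
    (hp0 : ∀ n σ z, MvPolynomial.eval (Var.val σ z) (p0 n) = (x σ z).1 n)
    (hq0 : ∀ n σ z, MvPolynomial.eval (Var.val σ z) (q0 n) = (x σ z).2 n)
    (hp1 : ∀ n σ z, MvPolynomial.eval (Var.val σ z) (p1 n) = (y σ z).1 n)
    (hq1 : ∀ n σ z, MvPolynomial.eval (Var.val σ z) (q1 n) = (y σ z).2 n) (μ σ : ℝ) (z : Amp N) :
    polyMap (fun n (μ : ℝ) => p0 n + MvPolynomial.C (μ : ℂ) * p1 n)
      (fun n (μ : ℝ) => q0 n + MvPolynomial.C (μ : ℂ) * q1 n) μ σ z = x σ z + μ • y σ z := by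
  unfold polyMap
  refine Prod.ext (funext fun n => ?_) (funext fun n => ?_)
  · simp only [map_add, map_mul, MvPolynomial.eval_C, hp0, hp1, Prod.fst_add, Pi.add_apply,
      Prod.smul_fst, Pi.smul_apply, Complex.real_smul]
  · simp only [map_add, map_mul, MvPolynomial.eval_C, hq0, hq1, Prod.snd_add, Pi.add_apply,
      Prod.smul_snd, Pi.smul_apply, Complex.real_smul]

theorem IsPolyVec.exists_polyMap {x y : ℝ → Amp N → Amp N} (hx : IsPolyVec x)
    (hy : IsPolyVec y) : ∃ PA PB : Fin (N + 1) → ℝ → MvPolynomial (Var N) ℂ,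
    (∀ n, PolynomialSmooth (PA n) ∧ PolynomialSmooth (PB n)) ∧
      ∀ μ σ z, polyMap PA PB μ σ z = x σ z + μ • y σ z := by
  obtain ⟨hx1, hx2⟩ := hx
  obtain ⟨hy1, hy2⟩ := hy
  unfold IsPoly at hx1 hx2 hy1 hy2
  choose p0 hp0 using hx1
  choose q0 hq0 using hx2
  choose p1 hp1 using hy1
  choose q1 hq1 using hy2
  refine ⟨fun n (μ : ℝ) => p0 n + MvPolynomial.C (μ : ℂ) * p1 n,
    fun n (μ : ℝ) => q0 n + MvPolynomial.C (μ : ℂ) * q1 n, ?_, ?_⟩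
  · exact fun n => ⟨polynomialSmooth_affine _ _, polynomialSmooth_affine _ _⟩
  · exact fun μ σ z => polyMap_affine hp0 hq0 hp1 hq1 μ σ z

theorem exists_polyMap : ∃ PA PB : Fin (N + 1) → ℝ → MvPolynomial (Var N) ℂ,
    (∀ n, PolynomialSmooth (PA n) ∧ PolynomialSmooth (PB n)) ∧
      ∀ μ σ z, polyMap PA PB μ σ z = ampChange D m μ σ z := by
  obtain ⟨PA, PB, hs, h⟩ := (isPolyVec_ampChange₀ D m).exists_polyMap (isPolyVec_ampChange₁ D)
  exact ⟨PA, PB, hs, fun μ σ z => (h μ σ z).trans (ampChange_eq D m μ σ z).symm⟩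

end Polynomials

/-! ### Phases and rotations. -/

section Phases

variable {N : ℕ}

theorem continuous_cutoff : Continuous cutoff := by
  unfold cutoff
  exact (continuous_pow 2).div (by fun_prop) fun σ => by positivity

theorem cutoff_le_one (σ : ℝ) : cutoff σ ≤ 1 := by
  unfold cutoff
  rw [div_le_one (by positivity)]
  linarith

/-- The phase is an integral from 0. Boundedness of `k` makes it converge there, however `σ`
behaves; the integrand is set to zero for `r ≤ 0`, where nothing is known of `σ`. -/
theorem exists_phase {σ k : ℝ → ℝ} (hσ : ContinuousOn σ (Set.Ioi 0)) (hk : Continuous k)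
    {K : ℝ} (hK : ∀ s, |k s| ≤ K) (a : ℝ) :
    ∃ φ : ℝ → ℝ, Continuous φ ∧ φ 0 = a ∧ ∀ r, 0 < r → HasDerivAt φ (k (σ r)) r := by
  set g : ℝ → ℝ := (Set.Ioi 0).indicator fun s => k (σ s)
  have hks : ContinuousOn (fun s => k (σ s)) (Set.Ioi 0) := hk.comp_continuousOn hσ
  have hm : MeasureTheory.AEStronglyMeasurable g :=
    (aestronglyMeasurable_indicator_iff measurableSet_Ioi).2
      (hks.aestronglyMeasurable measurableSet_Ioi)
  have hg : ∀ s, ‖g s‖ ≤ K := fun s =>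
    (norm_indicator_le_norm_self _ s).trans (hK _)
  have hi : ∀ b c : ℝ, IntervalIntegrable g MeasureTheory.volume b c := fun b c =>
    (intervalIntegrable_const (c := K)).mono_fun hm.restrict
      (.of_forall fun s => (hg s).trans (le_abs_self K))
  refine ⟨fun r => a + ∫ s in (0 : ℝ)..r, g s, ?_, by simp, fun r hr => ?_⟩
  · exact continuous_const.add (intervalIntegral.continuous_primitive hi 0)
  · have hgr : g =ᶠ[𝓝 r] fun s => k (σ s) := by
      filter_upwards [Ioi_mem_nhds hr] with s hs
      exact Set.indicator_of_mem hs _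
    have hc : ContinuousAt g r := (hks.continuousAt (Ioi_mem_nhds hr)).congr hgr.symm
    have h := intervalIntegral.integral_hasDerivAt_right (hi 0 r)
      hm.stronglyMeasurableAtFilter hc
    rw [hgr.self_of_nhds] at h
    exact h.const_add a

theorem hasDerivAt_amp_iff {z : ℝ → Amp N} {z' : Amp N} {r : ℝ} :
    HasDerivAt z z' r ↔ (∀ n, HasDerivAt (fun s => (z s).1 n) (z'.1 n) r) ∧
      ∀ n, HasDerivAt (fun s => (z s).2 n) (z'.2 n) r := by
  rw [← hasDerivAt_pi, ← hasDerivAt_pi]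
  constructor
  · intro h
    exact ⟨(ContinuousLinearMap.fst ℝ (Fin (N + 1) → ℂ) (Fin (N + 1) → ℂ)).hasFDerivAt.comp_hasDerivAt
        r h,
      (ContinuousLinearMap.snd ℝ (Fin (N + 1) → ℂ) (Fin (N + 1) → ℂ)).hasFDerivAt.comp_hasDerivAt
        r h⟩
  · rintro ⟨h1, h2⟩
    exact h1.prodMk h2

/-- `(A_n, B_n) ↦ (i k_n A_n, i k_n B_n)`. -/
def phaseField (k : Fin (N + 1) → ℝ) (z : Amp N) : Amp N :=
  (fun n => Complex.I * k n * z.1 n, fun n => Complex.I * k n * z.2 n)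

theorem hasDerivAt_rotate {φ : ℝ → Fin (N + 1) → ℝ} {k : Fin (N + 1) → ℝ} {p : ℝ → Amp N}
    {p' : Amp N} {r : ℝ} (hφ : ∀ n, HasDerivAt (fun s => φ s n) (k n) r)
    (hp : HasDerivAt p p' r) :
    HasDerivAt (fun s => rotate (φ s) (p s)) (rotate (φ r) (p' - phaseField k (p r))) r := by
  have he : ∀ n, HasDerivAt (fun s => Complex.exp (-(Complex.I * (φ s n : ℂ))))
      (Complex.exp (-(Complex.I * (φ r n : ℂ))) * (-(Complex.I * (k n : ℂ)))) r := fun n =>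
    (((hφ n).ofReal_comp.const_mul Complex.I).neg).cexp
  rw [hasDerivAt_amp_iff] at hp ⊢
  refine ⟨fun n => ((he n).mul (hp.1 n)).congr_deriv ?_,
    fun n => ((he n).mul (hp.2 n)).congr_deriv ?_⟩
  · simp only [rotate, phaseField, Prod.fst_sub, Pi.sub_apply]; ring
  · simp only [rotate, phaseField, Prod.snd_sub, Pi.sub_apply]; ring

theorem norm_exp_phase (t : ℝ) : ‖Complex.exp (-(Complex.I * (t : ℂ)))‖ = 1 := by
  simp [Complex.norm_exp]

theorem rotate_neg_rotate (θ : Fin (N + 1) → ℝ) (z : Amp N) :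
    rotate (fun n => -θ n) (rotate θ z) = z := by
  ext n <;> simp [rotate, ← mul_assoc, ← Complex.exp_add]

theorem norm_rotate_fst (θ : Fin (N + 1) → ℝ) (z : Amp N) (n : Fin (N + 1)) :
    ‖(rotate θ z).1 n‖ = ‖z.1 n‖ := by
  simp only [rotate, norm_mul, norm_exp_phase, one_mul]

theorem norm_rotate_snd (θ : Fin (N + 1) → ℝ) (z : Amp N) (n : Fin (N + 1)) :
    ‖(rotate θ z).2 n‖ = ‖z.2 n‖ := by
  simp only [rotate, norm_mul, norm_exp_phase, one_mul]

theorem size_rotate (θ : Fin (N + 1) → ℝ) (z : Amp N) : size (rotate θ z) = size z := by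
  unfold size
  simp only [Pi.norm_def]
  congr 3 <;> funext n <;> ext
  · exact norm_rotate_fst θ z n
  · exact norm_rotate_snd θ z n

theorem rotate_add (θ : Fin (N + 1) → ℝ) (x y : Amp N) :
    rotate θ (x + y) = rotate θ x + rotate θ y := by
  ext n <;> simp [rotate, mul_add]

/-- The truncated normal form is complex-linear and does not couple modes, hence it is equivariant;
only the remainder sees the phases. -/
theorem rotate_normalField (θ : Fin (N + 1) → ℝ) (c μ σ : ℝ) (z : Amp N) :
    rotate θ (normalField c μ σ z) = normalField c μ σ (rotate θ z) := by
  ext n <;> simp only [rotate, normalField] <;> ring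

theorem rotate_phaseField (θ k : Fin (N + 1) → ℝ) (z : Amp N) :
    rotate θ (phaseField k z) = phaseField k (rotate θ z) := by
  ext n <;> simp only [rotate, phaseField] <;> ring

theorem norm_le_size (z : Amp N) : ‖z‖ ≤ size z :=
  max_le (le_add_of_nonneg_right (norm_nonneg _)) (le_add_of_nonneg_left (norm_nonneg _))

theorem exists_size_ball {P : ℝ × ℝ × Amp N → Prop} (h : ∀ᶠ p in 𝓝 0, P p) :
    ∃ δ > 0, δ ≤ 1 ∧ ∀ μ σ z, |μ| < δ → |σ| < δ → size z < δ → P (μ, σ, z) := by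
  obtain ⟨ε, hε, hP⟩ := Metric.eventually_nhds_iff.1 h
  refine ⟨min ε 1, by positivity, min_le_right _ _, fun μ σ z hμ hσ hz => hP ?_⟩
  rw [dist_zero_right]
  exact (max_lt hμ (max_lt hσ ((norm_le_size z).trans_lt hz))).trans_le (min_le_left _ _)

end Phases

/-! ### The coordinate change near the origin. -/

section Change

variable (D : TuringData) (m : ℕ) {N : ℕ}

/-- The velocity of the phase of the `n`-th mode. -/
def phaseVelocity (n : Fin (N + 1)) (μ σ : ℝ) : ℝ :=
  1 - (coeffB₁ D + coeffA₀ D) / 4 * μ - radialCoeff m n / 2 * cutoff σ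

/-- All imaginary diagonal terms merge into one phase velocity per mode, which the rotation will
remove. -/
theorem ampReduction_reduced (μ σ : ℝ) (p : Amp N) :
    (ampReduction D m).reduced μ σ p =
      normalField D.c₀ μ σ p + phaseField (fun n => phaseVelocity D m n μ σ) p := by
  have h : (ampReduction D m).reduced μ σ p = linearPart p - (σ / 2) • p
      + μ • modewise (fun _ => paramNormal (coeffA₀ D) D.c₀ (coeffB₁ D)) p
      + cutoff σ • modewise (fun n => radialNormal (radialCoeff m n)) p := rfl
  rw [h]
  ext n <;>
  simp [linearPart, phaseMode, nilMode, paramNormal, radialNormal, normalField, phaseField,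
    phaseVelocity] <;> ring

theorem hasDerivAt_ampChange (μ : ℝ) {σ : ℝ → ℝ} {z : ℝ → Amp N} {r : ℝ}
    (hσ : HasDerivAt σ (-(σ r) ^ 2) r) (hz : HasDerivAt z (ampField D m μ (σ r) (z r)) r) :
    HasDerivAt (fun s => ampChange D m μ (σ s) (z s))
      ((ampReduction D m).reduced μ (σ r) (ampChange D m μ (σ r) (z r))
        + (ampReduction D m).defect μ (σ r) (shear (σ r) (z r))) r := by
  refine (ampReduction D m).hasDerivAt_change μ hσ ?_
  rw [← shear_ampField]
  have hT := (LinearMap.toContinuousLinearMap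
    (modewise (N := N) fun _ => shearMode)).hasFDerivAt.comp_hasDerivAt r hz
  refine (hz.add (hσ.smul hT)).congr_deriv ?_
  simp only [shear, neg_smul]
  change _ + (_ + -(σ r ^ 2 • modewise (fun _ => shearMode) (z r))) = _
  rw [← add_assoc, ← sub_eq_add_neg]
  rfl

theorem contDiff_shear : ContDiff ℝ ω (fun p : ℝ × ℝ × Amp N => shear p.2.1 p.2.2) := by
  have h := (LinearMap.toContinuousLinearMap (modewise (N := N) fun _ => shearMode)).contDiff
    (n := ω)
  exact contDiff_snd.snd.add (contDiff_snd.fst.smul (h.comp contDiff_snd.snd))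

theorem contDiff_ampChange :
    ContDiff ℝ ω (fun p : ℝ × ℝ × Amp N => ampChange D m p.1 p.2.1 p.2.2) :=
  (ampReduction D m).contDiff_change.comp
    (contDiff_fst.prodMk (contDiff_snd.fst.prodMk contDiff_shear))

theorem tendsto_shear :
    Tendsto (fun p : ℝ × ℝ × Amp N => (p.1, p.2.1, shear p.2.1 p.2.2)) (𝓝 0) (𝓝 0) := by
  have h : Continuous fun p : ℝ × ℝ × Amp N => (p.1, p.2.1, shear p.2.1 p.2.2) :=
    continuous_fst.prodMk (continuous_snd.fst.prodMk contDiff_shear.continuous)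
  exact h.tendsto' _ _ (by simp [shear])

theorem isBigO_shear_sub :
    (fun p : ℝ × ℝ × Amp N => shear p.2.1 p.2.2 - p.2.2) =o[𝓝 0] (fun p => p.2.2) := by
  have hσ : (fun p : ℝ × ℝ × Amp N => p.2.1) =o[𝓝 0] (fun _ => (1 : ℝ)) :=
    (isLittleO_one_iff ℝ).2 ((continuous_snd.fst).tendsto' _ _ rfl)
  have hT := (LinearMap.toContinuousLinearMap (modewise (N := N) fun _ => shearMode)).isBigO_comp
    (fun p : ℝ × ℝ × Amp N => p.2.2) (𝓝 0)
  exact (hσ.smul_isBigO hT).congr (fun p => by simp [shear]) (fun p => by simp)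

theorem isBigO_shear :
    (fun p : ℝ × ℝ × Amp N => shear p.2.1 p.2.2) =O[𝓝 0] (fun p => p.2.2) :=
  (isBigO_shear_sub.isBigO.add (isBigO_refl _ _)).congr_left fun p => by simp

theorem ampChange_sub_isLittleO :
    (fun p : ℝ × ℝ × Amp N => ampChange D m p.1 p.2.1 p.2.2 - p.2.2) =o[𝓝 0]
      (fun p => p.2.2) := by
  have h1 := (ampReduction D m (N := N)).isBigO_shift.comp_tendsto tendsto_shear
  have h2 : (gauge : ℝ × ℝ × Amp N → ℝ) =o[𝓝 0] (fun _ => (1 : ℝ)) := by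
    refine (isLittleO_one_iff ℝ).2 (Continuous.tendsto' ?_ _ _ ?_)
    · unfold gauge; fun_prop
    · simp [gauge]
  have h3 := (h2.comp_tendsto (tendsto_shear (N := N))).mul_isBigO
    (isBigO_shear (N := N)).norm_norm
  have h4 := (h1.trans_isLittleO h3)
  refine (isBigO_shear_sub.add (h4.congr_right fun p => by simp).of_norm_right).congr_left
    fun p => ?_
  simp [ampChange, Reduction.change]
  abel

/-- The linear part at `μ = 0` of the coordinate change, minus the identity. -/
def linearChange (n : Fin (N + 1)) (σ : ℝ) : (ℂ × ℂ) →ₗ[ℝ] (ℂ × ℂ) :=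
  σ • shearMode + σ ^ 2 • (radialChange (radialCoeff m n) ∘ₗ (LinearMap.id + σ • shearMode))

/-- Both `shearMode` and `radialChange` are upper triangular; the entry of `paramChange` from `A` to
`B` enters only with a factor `μ`. -/
theorem linearChange_snd (n : Fin (N + 1)) (σ : ℝ) (a : ℂ) :
    (linearChange m n σ (a, 0)).2 = 0 := by
  simp [linearChange, shearMode, radialChange]

theorem exists_linear_bound {E F : Type*} [NormedAddCommGroup E] [NormedSpace ℝ E]
    [FiniteDimensional ℝ E] [NormedAddCommGroup F] [NormedSpace ℝ F] (T : E →ₗ[ℝ] F) :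
    ∃ k, 0 ≤ k ∧ ∀ x, ‖T x‖ ≤ k * ‖x‖ :=
  ⟨_, norm_nonneg _, (LinearMap.toContinuousLinearMap T).le_opNorm⟩

theorem exists_linearChange_bound : ∃ K, ∀ (n : Fin (N + 1)) (σ : ℝ) (x : ℂ × ℂ), |σ| ≤ 1 →
    ‖linearChange m n σ x‖ ≤ K * |σ| * ‖x‖ := by
  obtain ⟨s, hs0, hs⟩ := exists_linear_bound shearMode
  choose c hc0 hc using fun n : Fin (N + 1) => exists_linear_bound (radialChange (radialCoeff m n))
  have hc : ∀ n x, ‖radialChange (radialCoeff m n) x‖ ≤ (∑ k, c k) * ‖x‖ := fun n x =>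
    (hc n x).trans (mul_le_mul_of_nonneg_right
      (Finset.single_le_sum (fun k _ => hc0 k) (Finset.mem_univ n)) (norm_nonneg x))
  have hc0 : 0 ≤ ∑ k, c k := Finset.sum_nonneg fun k _ => hc0 k
  refine ⟨s + (∑ k, c k) * (1 + s), fun n σ x hσ => ?_⟩
  have h1 : ‖σ • shearMode x‖ ≤ |σ| * (s * ‖x‖) := by
    rw [norm_smul, Real.norm_eq_abs]; gcongr; exact hs x
  have h2 : ‖x + σ • shearMode x‖ ≤ (1 + s) * ‖x‖ := by
    refine (norm_add_le _ _).trans ?_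
    have : |σ| * (s * ‖x‖) ≤ 1 * (s * ‖x‖) := by gcongr
    linarith
  have h3 : ‖σ ^ 2 • radialChange (radialCoeff m n) (x + σ • shearMode x)‖ ≤
      |σ| * ((∑ k, c k) * ((1 + s) * ‖x‖)) := by
    rw [norm_smul, norm_pow, Real.norm_eq_abs]
    refine mul_le_mul ?_ ((hc n _).trans (by gcongr)) (norm_nonneg _) (abs_nonneg _)
    exact pow_le_of_le_one (abs_nonneg _) hσ two_ne_zero
  refine (norm_add_le _ _).trans ((add_le_add h1 h3).trans_eq ?_)
  ring

theorem ampChange_sub_linear (μ σ : ℝ) (z : Amp N) :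
    ampChange D m μ σ z - (z + modewise (fun n => linearChange m n σ) z) =
      μ • (ampReduction D m).S₁ (shear σ z) + (ampReduction D m).H (shear σ z) (shear σ z)
        + σ • (ampReduction D m).H₂ (shear σ z) (shear σ z) := by
  have h : z + modewise (fun n => linearChange m n σ) z =
      shear σ z + σ ^ 2 • (ampReduction D m).S₂ (shear σ z) := by
    change _ = z + σ • modewise (fun _ => shearMode) z
      + σ ^ 2 • modewise (fun n => radialChange (radialCoeff m n)) (shear σ z)
    rw [add_assoc]
    rfl
  rw [h, ampChange, Reduction.change, Reduction.shift]
  abel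

theorem isBigO_ampChange_sub_linear :
    (fun p : ℝ × ℝ × Amp N => ampChange D m p.1 p.2.1 p.2.2
      - (p.2.2 + modewise (fun n => linearChange m n p.2.1) p.2.2)) =O[𝓝 0]
      (fun p => (|p.1| + ‖p.2.2‖) * ‖p.2.2‖) := by
  simp only [ampChange_sub_linear]
  have hy : (fun p : ℝ × ℝ × Amp N => shear p.2.1 p.2.2) =O[𝓝 0] (fun p => ‖p.2.2‖) :=
    isBigO_shear.norm_right
  have hmu : (fun p : ℝ × ℝ × Amp N => p.1) =O[𝓝 0] (fun p => |p.1| + ‖p.2.2‖) :=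
    .of_norm_le fun p => by
      rw [Real.norm_eq_abs]; linarith [norm_nonneg p.2.2]
  have hz : (fun p : ℝ × ℝ × Amp N => ‖p.2.2‖) =O[𝓝 0] (fun p => |p.1| + ‖p.2.2‖) :=
    .of_norm_le fun p => by
      rw [norm_norm]; linarith [abs_nonneg p.1]
  have hb : ∀ H : Amp N →L[ℝ] Amp N →L[ℝ] Amp N,
      (fun p : ℝ × ℝ × Amp N => H (shear p.2.1 p.2.2) (shear p.2.1 p.2.2)) =O[𝓝 0]
        (fun p => (|p.1| + ‖p.2.2‖) * ‖p.2.2‖) := fun H =>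
    (Reduction.isBigO_bil H hy hy).trans (hz.mul (isBigO_refl _ _))
  exact ((hmu.smul (((ampReduction D m).S₁.isBigO_comp _ _).trans hy)).add (hb _)).add
    (Reduction.isBigO_sigma_smul (hb _))

end Change

/-! ### The remainder and the equivalence of the two systems. -/

section Remainder

variable (D : TuringData) (m : ℕ) {N : ℕ}

/-- The remainder of the normal form, for a left inverse `S` of the coordinate change. -/
def remainder (S : ℝ × ℝ × Amp N → Amp N) (θ : Fin (N + 1) → ℝ) (w : Amp N) (σ μ : ℝ) : Amp N :=
  rotate θ ((ampReduction D m).defect μ σ (shear σ (S (μ, σ, rotate (fun n => -θ n) w))))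

theorem order_le (p : ℝ × ℝ × Amp N) :
    order p ≤ (|p.1| ^ 2 + |p.2.1| ^ 3 + size p.2.2 ^ 2) * size p.2.2 := by
  unfold order
  have := norm_le_size p.2.2
  gcongr

/-- The defect was estimated in the old coordinates; `S = O(y)` transfers the bound to the new ones.
-/
theorem isBigO_defect_comp {S : ℝ × ℝ × Amp N → Amp N} (hS : S =O[𝓝 0] (fun p => p.2.2))
    (hS0 : Tendsto (fun p => (p.1, p.2.1, S p)) (𝓝 0) (𝓝 0)) :
    (fun p => (ampReduction D m).defect p.1 p.2.1 (shear p.2.1 (S p))) =O[𝓝 0] order := by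
  have h1 := (ampReduction D m (N := N)).isBigO_defect.comp_tendsto (tendsto_shear.comp hS0)
  refine h1.trans ?_
  have h2 := (isBigO_shear.comp_tendsto hS0).trans hS
  obtain ⟨k, hk1, hk⟩ := h2.exists_pos.imp fun k h => h
  refine .of_bound ((1 + k ^ 2) * k) (hk.bound.mono fun p hp => ?_)
  simp only [Function.comp_apply] at hp ⊢
  unfold order
  rw [Real.norm_of_nonneg (by positivity), Real.norm_of_nonneg (by positivity)]
  calc (|p.1| ^ 2 + |p.2.1| ^ 3 + ‖shear p.2.1 (S p)‖ ^ 2) * ‖shear p.2.1 (S p)‖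
      ≤ (|p.1| ^ 2 + |p.2.1| ^ 3 + (k * ‖p.2.2‖) ^ 2) * (k * ‖p.2.2‖) := by gcongr
    _ ≤ ((1 + k ^ 2) * (|p.1| ^ 2 + |p.2.1| ^ 3 + ‖p.2.2‖ ^ 2)) * (k * ‖p.2.2‖) := by
        gcongr
        have h3 : 0 ≤ k ^ 2 * (|p.1| ^ 2 + |p.2.1| ^ 3) := by positivity
        nlinarith [sq_nonneg ‖p.2.2‖]
    _ = _ := by ring

/-- Rotations preserve `size`, so the bound is uniform in the phases. -/
theorem remainder_bound {S : ℝ × ℝ × Amp N → Amp N} {K : ℝ} (hK : 0 ≤ K)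
    (θ : Fin (N + 1) → ℝ) (w : Amp N) (σ μ : ℝ)
    (h : ‖(ampReduction D m).defect μ σ (shear σ (S (μ, σ, rotate (fun n => -θ n) w)))‖ ≤
      K * order (μ, σ, rotate (fun n => -θ n) w)) (n : Fin (N + 1)) :
    ‖(remainder D m S θ w σ μ).1 n‖ ≤ K * ((|μ| ^ 2 + |σ| ^ 3 + size w ^ 2) * size w) ∧
      ‖(remainder D m S θ w σ μ).2 n‖ ≤ K * ((|μ| ^ 2 + |σ| ^ 3 + size w ^ 2) * size w) := by
  have h1 := order_le (μ, σ, rotate (fun n => -θ n) w)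
  simp only [size_rotate] at h1
  have h2 := h.trans (mul_le_mul_of_nonneg_left h1 hK)
  unfold remainder
  rw [norm_rotate_fst, norm_rotate_snd]
  exact ⟨((norm_le_pi_norm _ n).trans (norm_fst_le _)).trans h2,
    ((norm_le_pi_norm _ n).trans (norm_snd_le _)).trans h2⟩

/-- The amplitude system turns into the normal form. -/
theorem hasDerivAt_normal {S : ℝ × ℝ × Amp N → Amp N} {μ : ℝ} {σ : ℝ → ℝ}
    {φ : ℝ → Fin (N + 1) → ℝ} {z w : ℝ → Amp N} {r : ℝ}
    (hσ : HasDerivAt σ (-(σ r) ^ 2) r)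
    (hφ : ∀ n, HasDerivAt (fun s => φ s n) (phaseVelocity D m n μ (σ r)) r)
    (hw : ∀ s, w s = rotate (φ s) (ampChange D m μ (σ s) (z s)))
    (hS : S (μ, σ r, ampChange D m μ (σ r) (z r)) = z r)
    (hz : HasDerivAt z (ampField D m μ (σ r) (z r)) r) :
    HasDerivAt w (normalField D.c₀ μ (σ r) (w r) + remainder D m S (φ r) (w r) (σ r) μ) r := by
  have h := hasDerivAt_rotate hφ (hasDerivAt_ampChange D m μ hσ hz)
  rw [show w = fun s => rotate (φ s) (ampChange D m μ (σ s) (z s)) from funext hw]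
  refine h.congr_deriv ?_
  simp only [remainder, rotate_neg_rotate, hS]
  rw [ampReduction_reduced, ← rotate_normalField, ← rotate_add]
  congr 1
  abel

/-- The normal form comes from the amplitude system. -/
theorem hasDerivAt_of_normal {S : ℝ × ℝ × Amp N → Amp N} {μ : ℝ} {σ : ℝ → ℝ}
    {φ : ℝ → Fin (N + 1) → ℝ} {z w : ℝ → Amp N} {r : ℝ}
    (hσ : HasDerivAt σ (-(σ r) ^ 2) r)
    (hφ : ∀ n, HasDerivAt (fun s => φ s n) (phaseVelocity D m n μ (σ r)) r)
    (hw : ∀ s, w s = rotate (φ s) (ampChange D m μ (σ s) (z s)))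
    (hS : ∀ᶠ s in 𝓝 r, S (μ, σ s, ampChange D m μ (σ s) (z s)) = z s)
    (hS' : ∀ᶠ p in 𝓝 (μ, σ r, z r), S (p.1, p.2.1, ampChange D m p.1 p.2.1 p.2.2) = p.2.2)
    (hSd : DifferentiableAt ℝ S (μ, σ r, ampChange D m μ (σ r) (z r)))
    (h : HasDerivAt w
      (normalField D.c₀ μ (σ r) (w r) + remainder D m S (φ r) (w r) (σ r) μ) r) :
    HasDerivAt z (ampField D m μ (σ r) (z r)) r := by
  have hp : (fun s => rotate (fun n => -φ s n) (w s)) =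
      fun s => ampChange D m μ (σ s) (z s) := by
    funext s; rw [hw, rotate_neg_rotate]
  have h1 := hasDerivAt_rotate (φ := fun s n => -φ s n) (fun n => (hφ n).neg) h
  rw [hp] at h1
  set p' := (ampReduction D m).reduced μ (σ r) (ampChange D m μ (σ r) (z r))
    + (ampReduction D m).defect μ (σ r) (shear (σ r) (z r)) with hp'
  have h2 : HasDerivAt (fun s => ampChange D m μ (σ s) (z s)) p' r := by
    refine h1.congr_deriv ?_
    have hneg : ∀ k : Fin (N + 1) → ℝ, ∀ x : Amp N,
        -phaseField (fun n => -k n) x = phaseField k x := by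
      intro k x
      ext n <;> simp [phaseField]
    rw [sub_eq_add_neg, hneg, rotate_add, rotate_add, rotate_normalField, rotate_phaseField,
      show rotate (fun n => -φ r n) (w r) = ampChange D m μ (σ r) (z r) from congrFun hp r,
      remainder, rotate_neg_rotate,
      show rotate (fun n => -φ r n) (w r) = ampChange D m μ (σ r) (z r) from congrFun hp r,
      hS.self_of_nhds, hp', ampReduction_reduced]
    abel
  -- The derivative of `S` along a curve depends only on the position and velocity of the curve.
  -- This is used for the solution and for a test curve.
  have comp : ∀ {s : ℝ → ℝ} {p : ℝ → Amp N} {t : ℝ},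
      HasDerivAt s (-(σ r) ^ 2) t → HasDerivAt p p' t → s t = σ r →
      p t = ampChange D m μ (σ r) (z r) → HasDerivAt (fun x => S (μ, s x, p x))
        (fderiv ℝ S (μ, σ r, ampChange D m μ (σ r) (z r)) (0, -(σ r) ^ 2, p')) t := by
    intro s p t hs hp hst hpt
    refine HasFDerivAt.comp_hasDerivAt (l := S) t ?_ ((hasDerivAt_const t μ).prodMk (hs.prodMk hp))
    rw [hst, hpt]
    exact hSd.hasFDerivAt
  have h3 := (comp hσ h2 rfl rfl).congr_of_eventuallyEq (hS.mono fun s hs => hs.symm)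
  -- The derivative of `S` is identified without computing it. The straight line through `z r` with
  -- velocity `ampField` has an image with the same position and velocity `p'`, and `S` takes this
  -- image back to the line. So `z` has the velocity of the line.
  have hc1 : HasDerivAt (fun t : ℝ => σ r + t * -(σ r) ^ 2) (-(σ r) ^ 2) 0 := by
    simpa using ((hasDerivAt_id (0 : ℝ)).mul_const (-(σ r) ^ 2)).const_add (σ r)
  have hc2 : HasDerivAt (fun t : ℝ => z r + t • ampField D m μ (σ r) (z r))
      (ampField D m μ (σ r) (z r)) 0 := by
    simpa using ((hasDerivAt_id (0 : ℝ)).smul_const (ampField D m μ (σ r) (z r))).const_add (z r)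
  have h4 := hasDerivAt_ampChange D m μ (σ := fun t : ℝ => σ r + t * -(σ r) ^ 2)
    (z := fun t : ℝ => z r + t • ampField D m μ (σ r) (z r)) (r := 0)
    (by simpa using hc1) (by simpa using hc2)
  simp only [zero_mul, add_zero, zero_smul] at h4
  have h5 := comp hc1 h4 (by simp) (by simp)
  have hct : Tendsto (fun t : ℝ => (μ, σ r + t * -(σ r) ^ 2,
      z r + t • ampField D m μ (σ r) (z r))) (𝓝 0) (𝓝 (μ, σ r, z r)) := by
    have hcc : Continuous (fun t : ℝ => (μ, σ r + t * -(σ r) ^ 2,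
      z r + t • ampField D m μ (σ r) (z r))) := by fun_prop
    exact hcc.tendsto' _ _ (by simp)
  have h6 := (h5.congr_of_eventuallyEq
    ((hct.eventually hS').mono fun t ht => ht.symm)).unique hc2
  rwa [h6] at h3

end Remainder

theorem exists_phaseVelocity_bound (D : TuringData) (m N : ℕ) :
    ∃ K, ∀ (n : Fin (N + 1)) μ σ, |phaseVelocity D m n μ σ - 1| ≤ K * (|μ| + |σ| ^ 2) := by
  set a := |(coeffB₁ D + coeffA₀ D) / 4|
  set b := ∑ n : Fin (N + 1), |radialCoeff m n / 2|
  have hb : ∀ n : Fin (N + 1), |radialCoeff m n / 2| ≤ b := fun n =>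
    Finset.single_le_sum (f := fun n : Fin (N + 1) => |radialCoeff m n / 2|)
      (fun k _ => abs_nonneg _) (Finset.mem_univ n)
  have ha : 0 ≤ a := abs_nonneg _
  have hb0 : 0 ≤ b := (abs_nonneg _).trans (hb 0)
  refine ⟨a + b, fun n μ σ => ?_⟩
  have h : phaseVelocity D m n μ σ - 1 =
      -((coeffB₁ D + coeffA₀ D) / 4 * μ) - radialCoeff m n / 2 * cutoff σ := by
    unfold phaseVelocity; ring
  rw [h]
  refine (abs_sub _ _).trans ?_
  rw [abs_neg, abs_mul, abs_mul, abs_of_nonneg (cutoff_nonneg σ), sq_abs]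
  calc a * |μ| + |radialCoeff m n / 2| * cutoff σ ≤ a * |μ| + b * σ ^ 2 := by
        gcongr
        · exact cutoff_nonneg σ
        · exact hb n
        · exact cutoff_le σ
    _ ≤ (a + b) * (|μ| + σ ^ 2) := by nlinarith [abs_nonneg μ, sq_nonneg σ]

theorem exists_phases (D : TuringData) (m N : ℕ) (μ : ℝ) {σ : ℝ → ℝ}
    (hσ : ∀ r, 0 < r → HasDerivAt σ (-(σ r) ^ 2) r) :
    ∃ φ : ℝ → Fin (N + 1) → ℝ, ∀ n, ContinuousOn (fun r => φ r n) (Set.Ici 0) ∧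
      φ 0 n = -((m : ℝ) * ((n : ℕ) : ℝ) * Real.pi / 2) ∧
      ∀ r, 0 < r → HasDerivAt (fun s => φ s n) (phaseVelocity D m n μ (σ r)) r := by
  have hc : ContinuousOn σ (Set.Ioi 0) := fun r hr => (hσ r hr).continuousAt.continuousWithinAt
  have h : ∀ n : Fin (N + 1), ∃ φ : ℝ → ℝ, Continuous φ ∧
      φ 0 = -((m : ℝ) * ((n : ℕ) : ℝ) * Real.pi / 2) ∧
      ∀ r, 0 < r → HasDerivAt φ (phaseVelocity D m n μ (σ r)) r := fun n => by
    refine exists_phase hc ?_ (K := |1 - (coeffB₁ D + coeffA₀ D) / 4 * μ| + |radialCoeff m n / 2|)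
      (fun s => ?_) _
    · unfold phaseVelocity
      exact continuous_const.sub (continuous_const.mul continuous_cutoff)
    · unfold phaseVelocity
      refine (abs_sub _ _).trans ?_
      rw [abs_mul _ (cutoff s), abs_of_nonneg (cutoff_nonneg s)]
      gcongr
      exact mul_le_of_le_one_right (abs_nonneg _) (cutoff_le_one s)
  choose φ h1 h2 h3 using h
  exact ⟨fun r n => φ n r, fun n => ⟨(h1 n).continuousOn, h2 n, h3 n⟩⟩

end FarField

end

/-- `PA, PB` are the components of the polynomial part of the coordinate change, `1 + T` its linear
part at `μ = 0`, `κ` the phase velocities, `R` the remainder. Its first argument is the vector of the current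
phases, since removing the phases leaves phase-dependent higher-order terms; along `σ = 1/r` the
phases are functions of `(μ, σ)`. -/
theorem mainTheorem8 (D : TuringData) (m N : ℕ) :
    ∃ (PA PB : Fin (N + 1) → ℝ → MvPolynomial (Var N) ℂ)
      (T : Fin (N + 1) → ℝ → (ℂ × ℂ) →ₗ[ℝ] (ℂ × ℂ))
      (κ : Fin (N + 1) → ℝ → ℝ → ℝ)
      (R : (Fin (N + 1) → ℝ) → Amp N → ℝ → ℝ → Amp N)
      (K δ : ℝ), 0 < K ∧ 0 < δ ∧
      -- polynomial in the amplitudes and `σ`, smooth in `μ`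
      (∀ n, PolynomialSmooth (PA n) ∧ PolynomialSmooth (PB n)) ∧
      -- `T n σ` is linear, upper triangular, and `O(σ)`
      (∀ n σ a, (T n σ (a, 0)).2 = 0) ∧
      (∀ n σ x, |σ| < δ → ‖T n σ x‖ ≤ K * |σ| * ‖x‖) ∧
      -- expansion of the coordinate change
      (∀ n μ σ z, |μ| < δ → |σ| < δ → size z < δ →
        ‖((polyMap PA PB μ σ z).1 n, (polyMap PA PB μ σ z).2 n)
            - ((z.1 n, z.2 n) + T n σ (z.1 n, z.2 n))‖
          ≤ K * ((|μ| + size z) * size z)) ∧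
      -- it is a change of coordinates: it has a smooth local inverse
      (∃ S : ℝ × ℝ × Amp N → Amp N,
        ContDiffOn ℝ ∞ S {p | |p.1| < δ ∧ |p.2.1| < δ ∧ size p.2.2 < δ} ∧
        ∀ μ σ z, |μ| < δ → |σ| < δ → size z < δ →
          S (μ, σ, polyMap PA PB μ σ z) = z ∧ polyMap PA PB μ σ (S (μ, σ, z)) = z) ∧
      -- order of the remainder
      (∀ θ w σ μ n, size w < δ → |σ| < δ → |μ| < δ →
        ‖(R θ w σ μ).1 n‖ ≤ K * ((|μ| ^ 2 + |σ| ^ 3 + size w ^ 2) * size w) ∧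
        ‖(R θ w σ μ).2 n‖ ≤ K * ((|μ| ^ 2 + |σ| ^ 3 + size w ^ 2) * size w)) ∧
      -- phase velocities
      (∀ n μ σ, |μ| < δ → |κ n μ σ - 1| ≤ K * (|μ| + |σ| ^ 2)) ∧
      -- along every solution `σ` there are phases such that the amplitude system becomes the
      -- normal form
      (∀ μ, |μ| < δ → ∀ σ : ℝ → ℝ, (∀ r, 0 < r → HasDerivAt σ (-(σ r) ^ 2) r) →
        ∃ φ : ℝ → Fin (N + 1) → ℝ,
          (∀ n, ContinuousOn (fun r => φ r n) (Set.Ici 0) ∧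
            φ 0 n = -((m : ℝ) * ((n : ℕ) : ℝ) * Real.pi / 2) ∧
            ∀ r, 0 < r → HasDerivAt (fun s => φ s n) (κ n μ (σ r)) r) ∧
          ∀ (J : Set ℝ) (z w : ℝ → Amp N), IsOpen J → J ⊆ Set.Ioi 0 →
            (∀ r ∈ J, |σ r| < δ ∧ size (z r) < δ) →
            (∀ r, w r = rotate (φ r) (polyMap PA PB μ (σ r) (z r))) →
            ((∀ r ∈ J, HasDerivAt z (ampField D m μ (σ r) (z r)) r) ↔
              ∀ r ∈ J, HasDerivAt w
                (normalField D.c₀ μ (σ r) (w r) + R (φ r) (w r) (σ r) μ) r)) := by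
  obtain ⟨PA, PB, hpoly, hP⟩ := exists_polyMap (N := N) D m
  obtain ⟨KT, hKT⟩ := exists_linearChange_bound (N := N) m
  obtain ⟨Kκ, hKκ⟩ := exists_phaseVelocity_bound D m N
  obtain ⟨S, hS1, hS2, hS3, hS4, hS5⟩ :=
    exists_smooth_inverse (contDiff_ampChange (N := N) D m) (ampChange_sub_isLittleO D m)
  obtain ⟨KL, hKL0, hKL⟩ := (isBigO_ampChange_sub_linear (N := N) D m).exists_pos
  obtain ⟨KR, hKR0, hKR⟩ := (isBigO_defect_comp D m hS2 hS3).exists_pos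
  -- `S` must be differentiable at image points, which need not lie in the ball of radius `δ`; hence
  -- its smoothness is also pulled back along the change.
  have hΦ : Filter.Tendsto (fun p : ℝ × ℝ × Amp N => (p.1, p.2.1, ampChange D m p.1 p.2.1 p.2.2))
      (nhds 0) (nhds 0) := by
    have hc : Continuous fun p : ℝ × ℝ × Amp N => (p.1, p.2.1, ampChange D m p.1 p.2.1 p.2.2) :=
      continuous_fst.prodMk (continuous_snd.fst.prodMk (contDiff_ampChange D m).continuous)
    refine hc.tendsto' _ _ ?_
    have := (ampChange_sub_isLittleO (N := N) D m).isBigO.eq_zero_imp.self_of_nhds (by simp)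
    simp only [Prod.snd_zero, sub_zero, Prod.fst_zero] at this
    simp [this]
  -- The left inverse property is required in a neighbourhood of each point of the ball, because the
  -- test curve in `hasDerivAt_of_normal` leaves the solution.
  obtain ⟨δ, hδ0, hδ1, hδ⟩ := exists_size_ball
    ((((((hKL.bound.and hKR.bound).and hS1).and hS5).and (eventually_eventually_nhds.2 hS4)).and
      (hΦ.eventually hS1)))
  set K := max (max KT Kκ) (max KL KR)
  have hK : 0 < K := hKL0.trans_le ((le_max_left _ _).trans (le_max_right _ _))
  have hKKT : KT ≤ K := (le_max_left _ _).trans (le_max_left _ _)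
  have hKKκ : Kκ ≤ K := (le_max_right _ _).trans (le_max_left _ _)
  have hKKL : KL ≤ K := (le_max_left _ _).trans (le_max_right _ _)
  have hKKR : KR ≤ K := (le_max_right _ _).trans (le_max_right _ _)
  have hPfun : ∀ μ σ, polyMap PA PB μ σ = ampChange D m μ σ := fun μ σ => funext (hP μ σ)
  refine ⟨PA, PB, ?_⟩
  simp only [hPfun]
  refine ⟨linearChange m, phaseVelocity D m, remainder D m S, K, δ, hK, hδ0, hpoly,
    fun n σ a => linearChange_snd m n σ a, fun n σ x hσ => ?_, fun n μ σ z hμ hσ hz => ?_,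
    ⟨S, fun p hp => ?_, fun μ σ z hμ hσ hz => ?_⟩, fun θ w σ μ n hw hσ hμ => ?_,
    fun n μ σ _ => ?_, fun μ hμ σ hσ => ?_⟩
  · refine (hKT n σ x (hσ.le.trans hδ1)).trans ?_
    gcongr
  · obtain ⟨⟨⟨⟨⟨h, -⟩, -⟩, -⟩, -⟩, -⟩ := hδ μ σ z hμ hσ hz
    have h1 : ‖(|μ| + ‖z‖) * ‖z‖‖ ≤ (|μ| + size z) * size z := by
      rw [Real.norm_of_nonneg (by positivity)]
      have h2 := norm_le_size z
      have h3 := (norm_nonneg z).trans h2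
      gcongr
    refine le_trans ?_ (h.trans (mul_le_mul hKKL h1 (norm_nonneg _) hK.le))
    set x := ampChange D m μ σ z - (z + modewise (fun n => linearChange m n σ) z) with hx
    have h2 : ((ampChange D m μ σ z).1 n, (ampChange D m μ σ z).2 n)
        - ((z.1 n, z.2 n) + linearChange m n σ (z.1 n, z.2 n)) = (x.1 n, x.2 n) := rfl
    rw [h2]
    exact max_le ((norm_le_pi_norm _ n).trans (norm_fst_le x))
      ((norm_le_pi_norm _ n).trans (norm_snd_le x))
  · obtain ⟨⟨⟨⟨-, h⟩, -⟩, -⟩, -⟩ := hδ p.1 p.2.1 p.2.2 hp.1 hp.2.1 hp.2.2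
    exact (h.of_le le_top).contDiffWithinAt
  · obtain ⟨⟨⟨-, h1⟩, h2⟩, -⟩ := hδ μ σ z hμ hσ hz
    exact ⟨h2.self_of_nhds, h1⟩
  · obtain ⟨⟨⟨⟨⟨-, h⟩, -⟩, -⟩, -⟩, -⟩ := hδ μ σ (rotate (fun n => -θ n) w) hμ hσ
      (by rwa [size_rotate])
    refine remainder_bound D m hK.le θ w σ μ (h.trans ?_) n
    rw [Real.norm_of_nonneg (by unfold order; positivity)]
    refine mul_le_mul_of_nonneg_right hKKR (by unfold order; positivity)
  · refine (hKκ n μ σ).trans ?_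
    gcongr
  · obtain ⟨φ, hφ⟩ := exists_phases D m N μ hσ
    refine ⟨φ, hφ, fun J z w hJ hJ0 hJδ hw => ?_⟩
    have hinv : ∀ r ∈ J, S (μ, σ r, ampChange D m μ (σ r) (z r)) = z r := fun r hr =>
      (hδ μ (σ r) (z r) hμ (hJδ r hr).1 (hJδ r hr).2).1.2.self_of_nhds
    constructor
    · intro h r hr
      exact hasDerivAt_normal D m (hσ r (hJ0 hr)) (fun n => (hφ n).2.2 r (hJ0 hr)) hw
        (hinv r hr) (h r hr)
    · intro h r hr
      have hr' := hδ μ (σ r) (z r) hμ (hJδ r hr).1 (hJδ r hr).2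
      refine hasDerivAt_of_normal D m (hσ r (hJ0 hr)) (fun n => (hφ n).2.2 r (hJ0 hr)) hw ?_
        hr'.1.2 (hr'.2.differentiableAt (by simp)) (h r hr)
      filter_upwards [hJ.mem_nhds hr] with s hs using hinv s hs
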